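/- Let $\mathcal N=(Q,\Sigma,\Delta,q_I)$ be a pushdown system of level 2 ($Q,\Sigma$ finite, $\bot\in\Sigma$ the bottom-of-stack symbol). A 2-stack is a nonempty sequence $w_1:\dots:w_k$ of nonempty words over $\Sigma$; its width is $|w_1:\dots:w_k|=k$ and $w_k$ is its topmost word. Transitions $(q_1,\sigma,q_2,op)\in\Delta$ apply in state $q_1$ if $\sigma$ is the topmost letter (the last letter of the topmost word), change the state to $q_2$ and perform $op$: push a letter $\ne\bot$ on the topmost word, delete its last letter ($\mathrm{pop}_1$), duplicate the topmost word ($\mathrm{clone}_2$), or delete it ($\mathrm{pop}_2$); pops that would create an empty word or stack are undefined. A configuration is a pair (state, 2-stack), and a run $\rho$ is a finite sequence $\rho(0)\to\rho(1)\to\cdots$ of configurations connected by transitions; $|\rho(j)|$ is the width of the stack of $\rho(j)$. A loop from $(q,t:w)$ to $(q',t:w)$ is a run between these configurations that does not visit $t$; it is a high loop if it also does not visit $\mathrm{pop}_1(t:w)$. A return from $(q,t:w)$ to $(q',t)$ is a run between these configurations that visits $t$ only in its final configuration. For a nonempty word $w$ let $\mathrm{Loop}^z(w)$, $\mathrm{HLoop}^z(w)$,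 $\mathrm{Ret}^z(w):Q\times Q\to\{0,\dots,z\}$ count loops, high loops and returns from state $q$ to state $q'$ with topmost word $w$, up to threshold $z$ (these do not depend on the stack $t$ below $w$, which may be empty for loops, and is nonempty for returns). For a word $w\in\Sigma^*$ let $w_{-i}$ be $w$ with its last $i$ letters deleted. Let $\mathrm{Lin}^0_z(w)$ be the structure on $\{0,\dots,|w|-1\}$ with the successor relation and with unary predicates telling, for each $i$: the last letter of $w_{-i}$; for $q,q'\in Q$ and $j\le z$, whether there are $j$ pairwise distinct runs from $(q,w)$ to $(q',w_{-i})$; and the values $\mathrm{Ret}^z(w_{-i})$, $\mathrm{Loop}^z(w_{-i})$, $\mathrm{HLoop}^z(w_{-i})$. Let $\mathrm{Lin}^{n+1}_z(w)$ be the expansion of $\mathrm{Lin}^n_z(w)$ by unary predicates telling for each $i$ the first-order theory of quantifier rank at most $z$ of $\mathrm{Lin}^n_z(w_{-i})$. Write $w\equiv^n_z w'$ if $\mathrm{Lin}^n_z(w)$ and $\mathrm{Lin}^n_z(w')$ satisfy the same first-order sentences of quantifier rank at most $z$, and let $|\Sigma^*/{\equiv^n_z}|$ be the number of classes. Proposition.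 Let $n,z,m\in\mathbb N$ with $n\ge1$, $m\ge1$, $z>m$ and $z\ge2$. Let $c=(q,s:w)$ and $\hat c=(q,\hat s:\hat w)$ be configurations with $w\equiv^n_z\hat w$ ($s$, $\hat s$ possibly empty). Let $\rho_1,\dots,\rho_m$ be pairwise distinct runs such that each $\rho_i$ starts in $c$, ends in $(q_i,s:w:w_i)$, and satisfies $|\rho_i(j)|>|s:w|$ for all $j\ge1$. Let $\hat\rho_1,\dots,\hat\rho_{m-1}$ be pairwise distinct runs such that each $\hat\rho_i$ starts in $\hat c$, ends in $(q_i,\hat s:\hat w:\hat w_i)$, and satisfies $|\hat\rho_i(j)|>|\hat s:\hat w|$ for all $j\ge1$. Assume $w_i\equiv^{n-1}_z\hat w_i$ for all $1\le i\le m-1$. Then there are a word $\hat w_m$ and a run $\hat\rho_m$ from $\hat c$ to $(q_m,\hat s:\hat w:\hat w_m)$ with $|\hat\rho_m(j)|>|\hat s:\hat w|$ for all $j\ge1$ such that $w_m\equiv^{n-1}_z\hat w_m$, $\hat\rho_m$ is distinct from each $\hat\rho_i$ with $1\le i<m$, and $$|\hat w_m|\le 1+|\hat w|+m\cdot|Q|\cdot|\Sigma^*/{\equiv^n_z}|.$$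 -/

import Mathlib

universe u v

/-!
Words over an alphabet `A` are lists and 2-stacks are lists of words, both written **from the
topmost entry down**: the head of a word is its topmost letter, the head of a stack is its topmost
word.  Thus the stack `s : w` (the word `w` put on top of the stack `s`) is `w :: s`,
`s : w : w'` is `w' :: w :: s`, and the prefix of `w` obtained by popping `i` letters
is `w.drop i`.
-/

/-- The type of lists of words over `A`, in the order described above; the 2-stacks are those
satisfying `IsStack` below. -/
abbrev Stack2 (A : Type v) : Type v := List (List A)

/-- `s` is a 2-stack, i.e. a nonempty sequence of nonempty words. -/
def Stack2.IsStack {A : Type v} (s : Stack2 A) : Prop :=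
  s ≠ [] ∧ ∀ w ∈ s, w ≠ []

/-- The level 2 stack operations over an alphabet with bottom-of-stack symbol `bot`;
`bot` is never pushed. -/
inductive StackOp {A : Type v} (bot : A) : Type v
  | push (a : {a : A // a ≠ bot})
  | clone2
  | pop1
  | pop2

/-- The partial action of the operations on 2-stacks. A pop operation is undefined if it would
create an empty word or an empty stack. -/
def StackOp.apply {A : Type v} {bot : A} : StackOp bot → Stack2 A → Option (Stack2 A)
  | .push a, w :: s => some ((a.1 :: w) :: s)
  | .clone2, w :: s => some (w :: w :: s)
  | .pop1, (_ :: b :: w) :: s => some ((b :: w) :: s)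
  | .pop2, _ :: w :: s => some (w :: s)
  | _, _ => none

/-- The topmost letter of a 2-stack. -/
def Stack2.top1 {A : Type v} (s : Stack2 A) : Option A :=
  s.head?.bind List.head?

/-- A pushdown system of level 2 with states `Q` and stack alphabet `A`. -/
structure TwoPS (Q : Type u) (A : Type v) where
  /-- the bottom-of-stack symbol -/
  bot : A
  /-- the transition relation -/
  trans : Set (Q × A × Q × StackOp bot)
  /-- the initial state -/
  init : Q

namespace TwoPS

variable {Q : Type u} {A : Type v}

/-- Configurations: a state together with a stack. -/
abbrev Config (Q : Type u) (A : Type v) : Type (max u v) := Q × Stack2 A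

/-- The type of (candidate) transitions `(q₁, σ, q₂, op)`. -/
abbrev Tr (N : TwoPS Q A) : Type (max u v) := Q × A × Q × StackOp N.bot

/-- The transition `δ` of `N` leads from the configuration `c` to the configuration `d`. -/
def Step (N : TwoPS Q A) (δ : N.Tr) (c d : Config Q A) : Prop :=
  δ ∈ N.trans ∧ c.1 = δ.1 ∧ c.2.top1 = some δ.2.1 ∧ d.1 = δ.2.2.1 ∧
    δ.2.2.2.apply c.2 = some d.2

/-- `IsRun N c [(δ₁, c₁), …, (δₙ, cₙ)]` says that `c →[δ₁] c₁ →[δ₂] ⋯ →[δₙ] cₙ`. -/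
def IsRun (N : TwoPS Q A) : Config Q A → List (N.Tr × Config Q A) → Prop
  | _, [] => True
  | c, (δ, d) :: l => N.Step δ c d ∧ N.IsRun d l

/-- A run of `N`: a finite sequence of configurations connected by transitions. -/
structure Run (N : TwoPS Q A) where
  /-- the initial configuration of the run -/
  start : Config Q A
  /-- the successive transitions, each with the configuration it leads to -/
  moves : List (N.Tr × Config Q A)
  valid : N.IsRun start moves

namespace Run

variable {N : TwoPS Q A}

/-- The configurations at the positions `j ≥ 1` of the run. -/
def later (ρ : N.Run) : List (Config Q A) := ρ.moves.map Prod.snd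

/-- All configurations of the run, in order. -/
def confs (ρ : N.Run) : List (Config Q A) := ρ.start :: ρ.later

/-- The final configuration of the run. -/
def finish (ρ : N.Run) : Config Q A := ρ.confs.getLast (List.cons_ne_nil _ _)

/-- The run leads from `c` to `d`. -/
def IsFromTo (ρ : N.Run) (c d : Config Q A) : Prop := ρ.start = c ∧ ρ.finish = d

/-- The run visits the stack `t`. -/
def Visits (ρ : N.Run) (t : Stack2 A) : Prop := ∃ c ∈ ρ.confs, c.2 = t

/-- All configurations at positions `j ≥ 1` have width greater than `k`. -/
def StaysAbove (ρ : N.Run) (k : ℕ) : Prop := ∀ c ∈ ρ.later, k < c.2.length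

end Run

/-- The loops from `(q, t : w)` to `(q', t : w)`: runs that do not pass `t`. -/
def loops (N : TwoPS Q A) (t : Stack2 A) (w : List A) (q q' : Q) : Set N.Run :=
  {ρ | ρ.IsFromTo (q, w :: t) (q', w :: t) ∧ ¬ ρ.Visits t}

/-- The high loops from `(q, t : w)` to `(q', t : w)`: loops that do not pass
`pop₁ (t : w)` either (which is no condition if that stack is undefined). -/
def highLoops (N : TwoPS Q A) (t : Stack2 A) (w : List A) (q q' : Q) : Set N.Run :=
  {ρ | ρ ∈ N.loops t w q q' ∧
    ∀ s, (StackOp.pop1 : StackOp N.bot).apply (w :: t) = some s → ¬ ρ.Visits s}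

/-- The returns from `(q, t : w)` to `(q', t)`: runs that visit `t` only in their
final configuration. -/
def returns (N : TwoPS Q A) (t : Stack2 A) (w : List A) (q q' : Q) : Set N.Run :=
  {ρ | ρ.IsFromTo (q, w :: t) (q', t) ∧ ∀ c ∈ ρ.confs.dropLast, c.2 ≠ t}

/-- The number of elements of `S` up to threshold `z`: it is `z` if `S` has at least `z`
elements. -/
noncomputable def countUpTo {α : Type*} (z : ℕ) (S : Set α) : Fin (z + 1) :=
  ⟨(min S.encard z).toNat,
    Nat.lt_succ_of_le (ENat.toNat_le_of_le_natCast (min_le_right _ _))⟩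

/-- Number of loops of the word `w` up to threshold `z`; it does not depend on
the stack below `w`, and we take the empty one. -/
noncomputable def loopFunc (N : TwoPS Q A) (z : ℕ) (w : List A) (q q' : Q) : Fin (z + 1) :=
  countUpTo z (N.loops [] w q q')

/-- Number of high loops of the word `w` up to threshold `z`; it does not depend on
the stack below `w`, and we take the empty one. -/
noncomputable def highLoopFunc (N : TwoPS Q A) (z : ℕ) (w : List A) (q q' : Q) : Fin (z + 1) :=
  countUpTo z (N.highLoops [] w q q')

/-- Number of returns of the word `w` up to threshold `z`; it does not depend on
the nonempty stack below `w`, and we take the initial one. -/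
noncomputable def returnFunc (N : TwoPS Q A) (z : ℕ) (w : List A) (q q' : Q) : Fin (z + 1) :=
  countUpTo z (N.returns [[N.bot]] w q q')

end TwoPS

/-! ### Word models and their first-order types -/

/-- The relation symbols of coloured successor structures with set of colours `C`. -/
inductive WordRel (C : Type u) : ℕ → Type u
  | succ : WordRel C 2
  | color (c : C) : WordRel C 1

/-- The relational first-order language of coloured successor structures. -/
def wordLang (C : Type u) : FirstOrder.Language.{0, u} := ⟨fun _ => Empty, WordRel C⟩

/-- The successor structure on `{0, …, ℓ - 1}` in which `i` has colour `c` iff `col i c`. -/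
@[reducible] def wordStructure {C : Type u} {ℓ : ℕ} (col : Fin ℓ → C → Prop) :
    (wordLang C).Structure (Fin ℓ) where
  funMap f := f.elim
  RelMap {_} r := match r with
    | .succ => fun x => (x 0 : ℕ) + 1 = x 1
    | .color c => fun x => col (x 0) c

/-- The quantifier rank of a first-order formula. -/
def quantRank {L : FirstOrder.Language.{0, u}} {α : Type} :
    {n : ℕ} → L.BoundedFormula α n → ℕ
  | _, .falsum => 0
  | _, .equal _ _ => 0
  | _, .rel _ _ => 0
  | _, .imp f g => max (quantRank f) (quantRank g)
  | _, .all f => quantRank f + 1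

/-- For every word `w` a colouring, by a set of colours `C`, of the positions of `w`.
Position `i` stands for the prefix of `w` obtained by popping `i` letters. -/
structure WordColoring (A : Type v) : Type (max v (u + 1)) where
  C : Type u
  col : (w : List A) → Fin w.length → C → Prop

/-- The quantifier rank `k` theory of the coloured word model of `w`. -/
def WordColoring.typ {A : Type v} (K : WordColoring.{u} A) (k : ℕ) (w : List A) :
    Set (wordLang K.C).Sentence :=
  {φ | quantRank φ ≤ k ∧ @FirstOrder.Language.Sentence.Realize _ _ (wordStructure (K.col w)) φ}

namespace TwoPS

variable {Q : Type u} {A : Type v}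

/-- The colours of the basic expanded word models: the letters `P_σ`, the predicates
`S^j_{q,q'}` for `j ≤ z`, and one predicate for every possible value of the return,
loop and high loop functions. -/
inductive BaseColor (Q : Type u) (A : Type v) (z : ℕ) : Type (max u v)
  | P (a : A)
  | S (q q' : Q) (j : Fin (z + 1))
  | R (f : Q → Q → Fin (z + 1))
  | L (f : Q → Q → Fin (z + 1))
  | H (f : Q → Q → Fin (z + 1))

/-- The basic expanded word model `Lin⁰(w)`. -/
def baseCol (N : TwoPS Q A) (z : ℕ) (w : List A) (i : Fin w.length) :
    BaseColor Q A z → Prop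
  | .P a => w[i] = a
  | .S q q' j => ∃ r : Fin j → N.Run, Function.Injective r ∧
      ∀ t, (r t).IsFromTo (q, [w]) (q', [w.drop i])
  | .R f => N.returnFunc z (w.drop i) = f
  | .L f => N.loopFunc z (w.drop i) = f
  | .H f => N.highLoopFunc z (w.drop i) = f

/-- The expanded word models `Linⁿ`: `Linⁿ⁺¹(w)` expands `Linⁿ(w)` by one predicate for every
rank `k` theory `θ` of some `Linⁿ(w')`, which holds at a position iff the corresponding
prefix `v` of `w` is such that `Linⁿ(v)` has theory `θ`. -/
def lin (N : TwoPS Q A) (k z : ℕ) : ℕ → WordColoring.{max u v} A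
  | 0 => ⟨BaseColor Q A z, N.baseCol z⟩
  | n + 1 =>
    ⟨(N.lin k z n).C ⊕ Set.range ((N.lin k z n).typ k),
      fun w i => Sum.elim ((N.lin k z n).col w i)
        (fun θ => (N.lin k z n).typ k (w.drop i) = θ)⟩

/-- The equivalence `≡ⁿ_z` on all words (including the empty one): equality of the
quantifier rank `z` theories of `Linⁿ(w)`, where `z` is also the counting threshold. -/
def wordSetoid (N : TwoPS Q A) (n z : ℕ) : Setoid (List A) :=
  Setoid.ker ((N.lin z z n).typ z)

/-- `w ≡ⁿ_z w'`. -/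
def WordEquiv (N : TwoPS Q A) (n z : ℕ) (w w' : List A) : Prop := N.wordSetoid n z w w'

/-- The number of equivalence classes of `≡ⁿ_z` on the set of all words. -/
noncomputable def numClasses (N : TwoPS Q A) (n z : ℕ) : ℕ :=
  Nat.card (Quotient (N.wordSetoid n z))

/-- The bound `1 + b + a · (|Q| · |Σ*/≡^c_d|)`. -/
noncomputable def oneStepBound (N : TwoPS Q A) (a b c d : ℕ) : ℕ :=
  1 + b + a * (Nat.card Q * N.numClasses c d)

end TwoPS

/-!
A run that starts in `(q, s : w)` and afterwards stays above `s : w` begins with a `clone₂`; from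
then on it modifies a copy of `w` and ends with a word `y` on top. If `v` is the longest common
suffix of `w` and `y` (words being written from the top down), say `y = x ++ v`, then the run pops
its copy of `w` down to `v` and builds up `x` from there (`TwoPS.IsFork`, `TwoPS.exists_isFork`).

**Counting.** Below, all sets of runs are sets of transition words on stacks *relative* to the part
below the topmost word (`TwoPS.RelStep`, `TwoPS.Path`), and they are compared by their cardinality
up to the threshold `z` (`SameCount`). Cutting a path at the last moment it enters, or the first
moment it leaves, the region where the bottom word of the relative stack has suffix `a :: v` gives
unique factorizations (`TwoPS.relRuns_cons_left`, `TwoPS.relRuns_cons_right`,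
`TwoPS.relRuns_cons_self`). A return or a high loop of `a :: v` uses `v` only through the returns
of copies of `v`, so it is a word over an alphabet of transitions and returns of `v`; hence the
numbers of returns and high loops of `a :: v` depend only on `a` and the numbers of returns of `v`
(`SameCount.labelled`, `TwoPS.sameCount_relReturns_cons`, `TwoPS.sameCount_relHighLoops`).

**Logic.** Word models are finite, so equality of rank `k` theories is back-and-forth equivalence
in `k` rounds (`WordColoring.typ_eq_iff`). Prepending a new first position preserves it, because
the round spent on the new position can be spent on recognizing the old first position
(`BackForth.cons_aux`). Together with the counting results this makes `≡ⁿ` a right congruence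
(`TwoPS.WordEquiv.cons`) with finitely many classes (`TwoPS.finite_quotient_wordSetoid`).

**Transfer.** Given at most `m < z` runs over `w`, Duplicator answers the suffixes `v` at which
they fork with suffixes `v'` of `wh`, with one round left to compare the letters above `v` and `v'`.
Then `w` to `x ++ v` and `wh` to `x ++ v'` carry the same number of runs up to `z`, and
`x ++ v ≡ⁿ⁻¹ x ++ v'` (`TwoPS.exists_injective_transfer`). By counting, some run over `wh` with the
required final state and class differs from the given ones. Choose one whose final word is
shortest. If it were longer than the bound, more than `m` of its intermediate words would agree in
state and class; cutting out the pieces between them gives `m` shorter final words of different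
lengths, one of which is the length of none of the `m - 1` given ones (`TwoPS.exists_shorter`).
-/

/-! ### Back-and-forth equivalence of coloured words -/

section BackForth

variable {C : Type u} {ℓ ℓ' : ℕ}

/-- The finite relation `P` is a partial isomorphism between two coloured successor structures:
it respects equality, successor, and the sets of colours. -/
def PartialIso (c : Fin ℓ → C → Prop) (c' : Fin ℓ' → C → Prop) (P : Set (Fin ℓ × Fin ℓ')) : Prop :=
  ∀ p ∈ P, ∀ p' ∈ P, (p.1 = p'.1 ↔ p.2 = p'.2) ∧
    ((p.1 : ℕ) + 1 = p'.1 ↔ (p.2 : ℕ) + 1 = p'.2) ∧ c p.1 = c' p.2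

/-- Duplicator wins the `k`-round Ehrenfeucht–Fraïssé game on two coloured successor structures
from the position in which exactly the pairs in `P` have been played. -/
def BackForth (c : Fin ℓ → C → Prop) (c' : Fin ℓ' → C → Prop) :
    ℕ → Set (Fin ℓ × Fin ℓ') → Prop
  | 0, P => PartialIso c c' P
  | k + 1, P => PartialIso c c' P ∧ (∀ x, ∃ y, BackForth c c' k (insert (x, y) P)) ∧
      ∀ y, ∃ x, BackForth c c' k (insert (x, y) P)

variable {c : Fin ℓ → C → Prop} {c' : Fin ℓ' → C → Prop} {P : Set (Fin ℓ × Fin ℓ')}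

theorem BackForth.partialIso {k : ℕ} (h : BackForth c c' k P) : PartialIso c c' P := by
  cases k with
  | zero => exact h
  | succ k => exact h.1

theorem BackForth.pred {k : ℕ} (h : BackForth c c' (k + 1) P) : BackForth c c' k P := by
  induction k generalizing P with
  | zero => exact h.1
  | succ k ih =>
    refine ⟨h.1, fun x => ?_, fun y => ?_⟩
    · obtain ⟨y, hy⟩ := h.2.1 x
      exact ⟨y, ih hy⟩
    · obtain ⟨x, hx⟩ := h.2.2 y
      exact ⟨x, ih hx⟩

theorem BackForth.mono {k k' : ℕ} (hk : k ≤ k') (h : BackForth c c' k' P) :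
    BackForth c c' k P := by
  induction hk with
  | refl => exact h
  | step _ ih => exact ih h.pred

/-- Passing to colours that are determined by the given ones preserves back-and-forth
equivalence. -/
theorem BackForth.recolor {D : Type*} {d : Fin ℓ → D → Prop} {d' : Fin ℓ' → D → Prop}
    (hcd : ∀ x y, c x = c' y → d x = d' y) {k : ℕ} (h : BackForth c c' k P) :
    BackForth d d' k P := by
  have key : ∀ P, PartialIso c c' P → PartialIso d d' P := fun P h p hp p' hp' =>
    ⟨(h p hp p' hp').1, (h p hp p' hp').2.1, hcd _ _ (h p hp p' hp').2.2⟩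
  induction k generalizing P with
  | zero => exact key _ h
  | succ k ih =>
    refine ⟨key _ h.1, fun x => ?_, fun y => ?_⟩
    · obtain ⟨y, hy⟩ := h.2.1 x
      exact ⟨y, ih hy⟩
    · obtain ⟨x, hx⟩ := h.2.2 y
      exact ⟨x, ih hx⟩

/-- One remaining round suffices to recognize the first position, the only one without
predecessor. -/
theorem BackForth.eq_zero_iff (h : BackForth c c' 1 P) {p : Fin ℓ × Fin ℓ'} (hp : p ∈ P) :
    (p.1 : ℕ) = 0 ↔ (p.2 : ℕ) = 0 := by
  constructor
  · intro h0
    by_contra hne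
    obtain ⟨x, hx⟩ := h.2.2 ⟨p.2 - 1, by omega⟩
    have := (hx.partialIso _ (Set.mem_insert _ _) p (Set.mem_insert_of_mem _ hp)).2.1
    simp only at this
    omega
  · intro h0
    by_contra hne
    obtain ⟨y, hy⟩ := h.2.1 ⟨p.1 - 1, by omega⟩
    have := (hy.partialIso _ (Set.mem_insert _ _) p (Set.mem_insert_of_mem _ hp)).2.1
    simp only at this
    omega

theorem BackForth.length_pos_iff {k : ℕ} (h : BackForth c c' (k + 1) P) : 0 < ℓ ↔ 0 < ℓ' := by
  constructor
  · intro h0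
    obtain ⟨y, _⟩ := h.2.1 ⟨0, h0⟩
    exact y.pos
  · intro h0
    obtain ⟨x, _⟩ := h.2.2 ⟨0, h0⟩
    exact x.pos

theorem BackForth.color_zero {k : ℕ} (h : BackForth c c' (k + 2) P) (h0 : 0 < ℓ) (h0' : 0 < ℓ') :
    c ⟨0, h0⟩ = c' ⟨0, h0'⟩ := by
  obtain ⟨y, hy⟩ := h.2.1 ⟨0, h0⟩
  have hy1 : BackForth c c' 1 (insert (⟨0, h0⟩, y) P) := hy.mono (by omega)
  have hz := (hy1.eq_zero_iff (Set.mem_insert _ _)).1 rfl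
  have : y = ⟨0, h0'⟩ := Fin.ext hz
  subst this
  exact (hy.partialIso _ (Set.mem_insert _ _) _ (Set.mem_insert _ _)).2.2

/-- Playing all elements of `V` costs one round for each. -/
theorem BackForth.exists_cover {k : ℕ} (V : Finset (Fin ℓ)) (h : BackForth c c' (k + V.card) P) :
    ∃ P', BackForth c c' k P' ∧ P ⊆ P' ∧ ∀ x ∈ V, ∃ y, (x, y) ∈ P' := by
  induction V using Finset.induction_on generalizing P with
  | empty => exact ⟨P, by simpa using h, subset_rfl, by simp⟩
  | insert a V ha ih =>
    rw [Finset.card_insert_of_notMem ha, ← add_assoc] at h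
    obtain ⟨y, hy⟩ := h.2.1 a
    obtain ⟨P', h1, h2, h3⟩ := ih hy
    refine ⟨P', h1, (Set.subset_insert _ _).trans h2, fun x hx => ?_⟩
    rcases Finset.mem_insert.1 hx with rfl | hx
    · exact ⟨y, h2 (Set.mem_insert _ _)⟩
    · exact h3 x hx

/-- Back-and-forth equivalence is preserved by prepending a first position. As long as the new
position has not been played, the game on the old structures has equally many rounds left;
afterwards it has one more, which keeps the old first positions matched with each other. -/
theorem BackForth.cons_aux {d : Fin (ℓ + 1) → C → Prop} {d' : Fin (ℓ' + 1) → C → Prop}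
    (h0 : d 0 = d' 0) (hs : ∀ x y, c x = c' y → d x.succ = d' y.succ) {k : ℕ} :
    ∀ {P}, (BackForth c c' k P → BackForth d d' k (Prod.map Fin.succ Fin.succ '' P)) ∧
      (BackForth c c' (k + 1) P →
        BackForth d d' k (insert (0, 0) (Prod.map Fin.succ Fin.succ '' P))) := by
  have a1 : ∀ P, PartialIso c c' P → PartialIso d d' (Prod.map Fin.succ Fin.succ '' P) := by
    rintro P h _ ⟨p, hp, rfl⟩ _ ⟨p', hp', rfl⟩
    obtain ⟨h1, h2, h3⟩ := h p hp p' hp'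
    refine ⟨by simpa using h1, by simpa using h2, hs _ _ h3⟩
  have a2 : ∀ P, BackForth c c' 1 P →
      PartialIso d d' (insert (0, 0) (Prod.map Fin.succ Fin.succ '' P)) := by
    rintro P h p (rfl | ⟨p, hp, rfl⟩) p' (rfl | ⟨p', hp', rfl⟩)
    · simpa using h0
    · have := h.eq_zero_iff hp'
      refine ⟨?_, ?_, h0⟩
      · simp [Fin.ext_iff]
      · simpa [eq_comm] using this
    · obtain ⟨h1, h2, h3⟩ := h.partialIso p hp p hp
      refine ⟨?_, ?_, hs _ _ h3⟩
      · simp [Fin.ext_iff]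
      · simp
    · exact a1 P h.partialIso _ ⟨p, hp, rfl⟩ _ ⟨p', hp', rfl⟩
  induction k with
  | zero => exact fun {P} => ⟨a1 P, a2 P⟩
  | succ k ih =>
    intro P
    refine ⟨fun h => ⟨a1 P h.1, fun x => ?_, fun y => ?_⟩,
      fun h => ⟨a2 P (h.mono (by omega)), fun x => ?_, fun y => ?_⟩⟩
    · induction x using Fin.cases with
      | zero => exact ⟨0, ih.2 h⟩
      | succ x =>
        obtain ⟨y, hy⟩ := h.2.1 x
        exact ⟨y.succ, by simpa [Set.image_insert_eq] using ih.1 hy⟩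
    · induction y using Fin.cases with
      | zero => exact ⟨0, ih.2 h⟩
      | succ y =>
        obtain ⟨x, hx⟩ := h.2.2 y
        exact ⟨x.succ, by simpa [Set.image_insert_eq] using ih.1 hx⟩
    · induction x using Fin.cases with
      | zero => exact ⟨0, by simpa using ih.2 h.pred⟩
      | succ x =>
        obtain ⟨y, hy⟩ := h.2.1 x
        refine ⟨y.succ, ?_⟩
        rw [Set.insert_comm]
        simpa [Set.image_insert_eq] using ih.2 hy
    · induction y using Fin.cases with
      | zero => exact ⟨0, by simpa using ih.2 h.pred⟩
      | succ y =>
        obtain ⟨x, hx⟩ := h.2.2 y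
        refine ⟨x.succ, ?_⟩
        rw [Set.insert_comm]
        simpa [Set.image_insert_eq] using ih.2 hx

end BackForth

/-! ### First-order theories of bounded quantifier rank -/

section Types

open FirstOrder Language

variable {C : Type u} {ℓ ℓ' : ℕ} {c : Fin ℓ → C → Prop} {c' : Fin ℓ' → C → Prop}

/-- Truth of a formula in the word model with colouring `c`, under the assignment `a`. -/
def RealizeIn {n : ℕ} (c : Fin ℓ → C → Prop) (φ : (wordLang C).BoundedFormula Empty n)
    (a : Fin n → Fin ℓ) : Prop :=
  @BoundedFormula.Realize _ _ (wordStructure c) _ _ φ default a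

theorem realizeIn_all {n : ℕ} {φ : (wordLang C).BoundedFormula Empty (n + 1)} {a : Fin n → Fin ℓ} :
    RealizeIn c φ.all a ↔ ∀ x, RealizeIn c φ (Fin.snoc a x) := Iff.rfl

theorem realizeIn_imp {n : ℕ} {φ ψ : (wordLang C).BoundedFormula Empty n} {a : Fin n → Fin ℓ} :
    RealizeIn c (φ.imp ψ) a ↔ (RealizeIn c φ a → RealizeIn c ψ a) := Iff.rfl

theorem realizeIn_not {n : ℕ} {φ : (wordLang C).BoundedFormula Empty n} {a : Fin n → Fin ℓ} :
    RealizeIn c φ.not a ↔ ¬ RealizeIn c φ a := Iff.rfl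

theorem range_snoc_pair {n : ℕ} {X Y : Type*} (a : Fin n → X) (b : Fin n → Y) (x : X) (y : Y) :
    Set.range (fun i => ((Fin.snoc a x : Fin (n + 1) → X) i, (Fin.snoc b y : Fin (n + 1) → Y) i)) =
      insert (x, y) (Set.range fun i => (a i, b i)) := by
  rw [← Fin.range_snoc]
  congr 1
  funext i
  induction i using Fin.lastCases <;> simp

/-- Conjunctions of finitely many formulas do not increase the quantifier rank. -/
theorem exists_conj {n k : ℕ} (L : List ((wordLang C).BoundedFormula Empty n))
    (hL : ∀ φ ∈ L, quantRank φ ≤ k) :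
    ∃ χ : (wordLang C).BoundedFormula Empty n, quantRank χ ≤ k ∧
      ∀ (ℓ : ℕ) (c : Fin ℓ → C → Prop) a, RealizeIn c χ a ↔ ∀ φ ∈ L, RealizeIn c φ a := by
  induction L with
  | nil => exact ⟨BoundedFormula.falsum.imp .falsum, by simp [quantRank],
      fun _ _ _ => by simp [realizeIn_imp]⟩
  | cons φ L ih =>
    obtain ⟨χ, h1, h2⟩ := ih fun φ h => hL φ (List.mem_cons_of_mem _ h)
    refine ⟨(φ.imp χ.not).not, ?_, fun ℓ c a => ?_⟩
    · have := hL φ (List.mem_cons_self ..)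
      simp [quantRank, h1, this]
    · simp [realizeIn_not, realizeIn_imp, h2]

theorem term_eq_var {n : ℕ} (t : (wordLang C).Term (Empty ⊕ Fin n)) :
    ∃ i, t = Term.var (Sum.inr i) := by
  match t with
  | .var (.inl x) => exact x.elim
  | .var (.inr i) => exact ⟨i, rfl⟩
  | .func f _ => exact Empty.elim f

theorem BackForth.realizeIn_iff {n : ℕ} (φ : (wordLang C).BoundedFormula Empty n) {k : ℕ}
    (hφ : quantRank φ ≤ k) {a : Fin n → Fin ℓ} {b : Fin n → Fin ℓ'}
    (h : BackForth c c' k (Set.range fun i => (a i, b i))) :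
    RealizeIn c φ a ↔ RealizeIn c' φ b := by
  induction φ generalizing k with
  | falsum => rfl
  | equal t₁ t₂ =>
    obtain ⟨i, rfl⟩ := term_eq_var t₁
    obtain ⟨j, rfl⟩ := term_eq_var t₂
    exact (h.partialIso _ ⟨i, rfl⟩ _ ⟨j, rfl⟩).1
  | rel R ts =>
    cases R with
    | succ =>
      obtain ⟨i, hi⟩ := term_eq_var (ts 0)
      obtain ⟨j, hj⟩ := term_eq_var (ts 1)
      change ((_ : ℕ) + 1 = _) ↔ ((_ : ℕ) + 1 = _)
      simp only [hi, hj]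
      exact (h.partialIso _ ⟨i, rfl⟩ _ ⟨j, rfl⟩).2.1
    | color x =>
      obtain ⟨i, hi⟩ := term_eq_var (ts 0)
      change c _ _ ↔ c' _ _
      simp only [hi]
      exact iff_of_eq (congrFun (h.partialIso _ ⟨i, rfl⟩ _ ⟨i, rfl⟩).2.2 x)
  | imp f g ihf ihg =>
    simp only [quantRank, max_le_iff] at hφ
    rw [realizeIn_imp, realizeIn_imp, ihf hφ.1 h, ihg hφ.2 h]
  | all f ih =>
    obtain ⟨k, rfl⟩ : ∃ k', k = k' + 1 := ⟨k - 1, by simp only [quantRank] at hφ; omega⟩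
    simp only [quantRank, Nat.add_le_add_iff_right] at hφ
    rw [realizeIn_all, realizeIn_all]
    constructor
    · intro H y
      obtain ⟨x, hx⟩ := h.2.2 y
      rw [← range_snoc_pair] at hx
      exact (ih hφ hx).1 (H x)
    · intro H x
      obtain ⟨y, hy⟩ := h.2.1 x
      rw [← range_snoc_pair] at hy
      exact (ih hφ hy).2 (H y)

theorem partialIso_of_realizeIn_iff {n k : ℕ} {a : Fin n → Fin ℓ} {b : Fin n → Fin ℓ'}
    (h : ∀ φ : (wordLang C).BoundedFormula Empty n, quantRank φ ≤ k →
      (RealizeIn c φ a ↔ RealizeIn c' φ b)) :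
    PartialIso c c' (Set.range fun i => (a i, b i)) := by
  rintro _ ⟨i, rfl⟩ _ ⟨j, rfl⟩
  refine ⟨?_, ?_, funext fun x => propext ?_⟩
  · exact h (.equal (.var (.inr i)) (.var (.inr j))) (Nat.zero_le _)
  · exact h (.rel (WordRel.succ : WordRel C 2) ![.var (.inr i), .var (.inr j)]) (Nat.zero_le _)
  · exact h (.rel (WordRel.color x : WordRel C 1) ![.var (.inr i)]) (Nat.zero_le _)

/-- The back-and-forth step for tuples satisfying the same formulas of rank `k + 1`. As the
second structure is finite, the formulas refuting its elements as answers to `x` have a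
conjunction, whatever the set of colours. -/
theorem exists_pebble {n k : ℕ} {a : Fin n → Fin ℓ} {b : Fin n → Fin ℓ'}
    (h : ∀ φ : (wordLang C).BoundedFormula Empty n, quantRank φ ≤ k + 1 →
      (RealizeIn c φ a ↔ RealizeIn c' φ b)) (x : Fin ℓ) :
    ∃ y, ∀ φ : (wordLang C).BoundedFormula Empty (n + 1), quantRank φ ≤ k →
      (RealizeIn c φ (Fin.snoc a x) ↔ RealizeIn c' φ (Fin.snoc b y)) := by
  by_contra! H
  have H' : ∀ y, ∃ φ : (wordLang C).BoundedFormula Empty (n + 1), quantRank φ ≤ k ∧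
      RealizeIn c φ (Fin.snoc a x) ∧ ¬ RealizeIn c' φ (Fin.snoc b y) := by
    intro y
    obtain ⟨φ, h1, ⟨h2, h3⟩ | ⟨h2, h3⟩⟩ := H y
    · exact ⟨φ, h1, h2, h3⟩
    · exact ⟨φ.not, by simpa [quantRank, BoundedFormula.not] using h1,
        realizeIn_not.2 h2, fun h => h h3⟩
  choose f hf1 hf2 hf3 using H'
  obtain ⟨χ, hχ, hr⟩ := exists_conj (List.ofFn f) (k := k) (by simpa [List.mem_ofFn] using hf1)
  have := h χ.not.all (by simpa [quantRank, BoundedFormula.not] using hχ)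
  simp only [realizeIn_all, realizeIn_not, hr, List.mem_ofFn, forall_exists_index,
    forall_apply_eq_imp_iff] at this
  exact this.2 (fun y hy => hf3 y (hy y)) x fun y => hf2 y

theorem backForth_of_realizeIn_iff {n k : ℕ} {a : Fin n → Fin ℓ} {b : Fin n → Fin ℓ'}
    (h : ∀ φ : (wordLang C).BoundedFormula Empty n, quantRank φ ≤ k →
      (RealizeIn c φ a ↔ RealizeIn c' φ b)) :
    BackForth c c' k (Set.range fun i => (a i, b i)) := by
  induction k generalizing n with
  | zero => exact partialIso_of_realizeIn_iff h
  | succ k ih =>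
    refine ⟨partialIso_of_realizeIn_iff h, fun x => ?_, fun y => ?_⟩
    · obtain ⟨y, hy⟩ := exists_pebble h x
      exact ⟨y, by simpa only [range_snoc_pair] using ih hy⟩
    · obtain ⟨x, hx⟩ := exists_pebble (fun φ hφ => (h φ hφ).symm) y
      exact ⟨x, by simpa only [range_snoc_pair] using ih fun φ hφ => (hx φ hφ).symm⟩

/-- The Ehrenfeucht–Fraïssé theorem for word models. -/
theorem WordColoring.typ_eq_iff {A : Type v} (K : WordColoring.{u} A) (k : ℕ) (w w' : List A) :
    K.typ k w = K.typ k w' ↔ BackForth (K.col w) (K.col w') k ∅ := by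
  have e : (∅ : Set (Fin w.length × Fin w'.length)) =
      Set.range fun i : Fin 0 => ((default : Fin 0 → _) i, (default : Fin 0 → _) i) := by simp
  rw [e]
  constructor
  · intro h
    refine backForth_of_realizeIn_iff fun φ hφ => ?_
    have := Set.ext_iff.1 h φ
    exact ⟨fun hr => (this.1 ⟨hφ, hr⟩).2, fun hr => (this.2 ⟨hφ, hr⟩).2⟩
  · intro h
    ext φ
    exact and_congr_right fun hφ => h.realizeIn_iff φ hφ

/-- The possible atomic types of `n`-tuples in word models with set of colours `C`: the pairs of
equal entries, the pairs of consecutive entries, and the colours of the entries. -/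
abbrev AtomCode (C : Type u) (n : ℕ) : Type u :=
  Set (Fin n × Fin n) × Set (Fin n × Fin n) × Set (Fin n × C)

/-- A type of codes for the rank `k` types of `n`-tuples in word models; it is finite if `C` is. -/
def TypeCode (C : Type u) : ℕ → ℕ → Type u
  | 0, n => AtomCode C n
  | k + 1, n => AtomCode C n × Set (TypeCode C k (n + 1))

instance TypeCode.finite [Finite C] (k n : ℕ) : Finite (TypeCode C k n) := by
  induction k generalizing n with
  | zero => unfold TypeCode; infer_instance
  | succ k ih => unfold TypeCode; infer_instance

/-- The atomic type of a tuple. -/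
def atomCode (c : Fin ℓ → C → Prop) {n : ℕ} (a : Fin n → Fin ℓ) : AtomCode C n :=
  ({p | a p.1 = a p.2}, {p | (a p.1 : ℕ) + 1 = a p.2}, {p | c (a p.1) p.2})

/-- The code of the rank `k` type of a tuple: its atomic type and the codes of the rank `k - 1`
types of its extensions by one element. -/
def typeCode (c : Fin ℓ → C → Prop) : (k n : ℕ) → (Fin n → Fin ℓ) → TypeCode C k n
  | 0, _, a => atomCode c a
  | k + 1, n, a => (atomCode c a, Set.range fun x => typeCode c k (n + 1) (Fin.snoc a x))

theorem partialIso_of_atomCode_eq {n : ℕ} {a : Fin n → Fin ℓ} {b : Fin n → Fin ℓ'}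
    (h : atomCode c a = atomCode c' b) :
    PartialIso c c' (Set.range fun i => (a i, b i)) := by
  rintro _ ⟨i, rfl⟩ _ ⟨j, rfl⟩
  obtain ⟨h1, h2⟩ := Prod.ext_iff.1 h
  obtain ⟨h2, h3⟩ := Prod.ext_iff.1 h2
  exact ⟨Set.ext_iff.1 h1 (i, j), Set.ext_iff.1 h2 (i, j),
    funext fun x => propext (Set.ext_iff.1 h3 (i, x))⟩

theorem backForth_of_typeCode_eq {k n : ℕ} {a : Fin n → Fin ℓ} {b : Fin n → Fin ℓ'}
    (h : typeCode c k n a = typeCode c' k n b) :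
    BackForth c c' k (Set.range fun i => (a i, b i)) := by
  induction k generalizing n with
  | zero => exact partialIso_of_atomCode_eq h
  | succ k ih =>
    obtain ⟨h1, h2⟩ := Prod.ext_iff.1 h
    refine ⟨partialIso_of_atomCode_eq h1, fun x => ?_, fun y => ?_⟩
    · obtain ⟨y, hy⟩ := (Set.ext_iff.1 h2 _).1 ⟨x, rfl⟩
      exact ⟨y, by simpa only [range_snoc_pair] using ih hy.symm⟩
    · obtain ⟨x, hx⟩ := (Set.ext_iff.1 h2 _).2 ⟨y, rfl⟩
      exact ⟨x, by simpa only [range_snoc_pair] using ih hx⟩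

/-- With finitely many colours there are only finitely many rank `k` theories of word models. -/
theorem WordColoring.finite_range_typ {A : Type v} (K : WordColoring.{u} A) [Finite K.C] (k : ℕ) :
    (Set.range (K.typ k)).Finite := by
  have : ∀ w w', typeCode (K.col w) k 0 default = typeCode (K.col w') k 0 default →
      K.typ k w = K.typ k w' := by
    intro w w' h
    rw [WordColoring.typ_eq_iff]
    simpa using backForth_of_typeCode_eq h
  have hf : Function.FactorsThrough (K.typ k) fun w => typeCode (K.col w) k 0 default :=
    fun w w' h => this w w' h
  obtain ⟨g, hg⟩ := (Function.factorsThrough_iff _).1 hf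
  rw [hg]
  exact (Set.finite_range g).subset (Set.range_comp_subset_range _ _)

end Types

/-! ### Counting up to a threshold -/

section Counting

/-- `S` and `T` have the same number of elements, where all numbers from `z` on are identified. -/
def SameCount (z : ℕ) {α β : Type*} (S : Set α) (T : Set β) : Prop :=
  min S.encard z = min T.encard z

variable {α β γ E : Type*} {z : ℕ}

theorem SameCount.refl (S : Set α) : SameCount z S S := rfl

theorem SameCount.symm {S : Set α} {T : Set β} (h : SameCount z S T) : SameCount z T S :=
  Eq.symm h

theorem SameCount.le_encard {S : Set α} {T : Set β} (h : SameCount z S T) {k : ℕ∞} (hk : k ≤ z)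
    (hS : k ≤ S.encard) : k ≤ T.encard :=
  (h ▸ le_min hS hk : k ≤ min T.encard z).trans (min_le_left _ _)

theorem SameCount.nonempty {S : Set α} {T : Set β} (h : SameCount z S T) (hz : 1 ≤ z)
    (hS : S.Nonempty) : T.Nonempty := by
  rw [← Set.one_le_encard_iff_nonempty] at hS ⊢
  exact h.le_encard (by exact_mod_cast hz) hS

theorem SameCount.encard_eq {S : Set α} {T : Set β} (h : SameCount z S T) (hS : S.encard < z) :
    S.encard = T.encard := by
  have h' : S.encard = min T.encard z := by rw [← h, min_eq_left hS.le]
  rcases min_choice T.encard (z : ℕ∞) with h1 | h1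
  · rw [h', h1]
  · rw [h1] at h'
    exact absurd h' hS.ne

theorem SameCount.union {S S' : Set α} {T T' : Set β} (h : SameCount z S T)
    (h' : SameCount z S' T') (hS : Disjoint S S') (hT : Disjoint T T') :
    SameCount z (S ∪ S') (T ∪ T') := by
  have key : ∀ a b : ℕ∞, min (a + b) (z : ℕ∞) = min (min a z + min b z) z := by
    intro a b
    rcases le_total a z with ha | ha
    · rcases le_total b z with hb | hb
      · rw [min_eq_left ha, min_eq_left hb]
      · rw [min_eq_left ha, min_eq_right hb, min_eq_right (hb.trans le_add_self),
          min_eq_right le_add_self]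
    · rw [min_eq_right ha, min_eq_right (ha.trans le_self_add), min_eq_right le_self_add]
  rw [SameCount, Set.encard_union_eq hS, Set.encard_union_eq hT, key, h, h', ← key]

/-- The lists that arise from a word in `L` by labelling each occurrence of a letter `e` with an
element of `X e`. -/
def labelled (L : Set (List E)) (X : E → Set β) : Set (List (E × β)) :=
  {l | l.map Prod.fst ∈ L ∧ ∀ p ∈ l, p.2 ∈ X p.1}

/-- One half of `SameCount.labelled`. -/
theorem encard_labelled_le [Nonempty β] (L : Set (List E)) {X : E → Set α} {Y : E → Set β}
    (h : ∀ e, SameCount z (X e) (Y e)) :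
    min (labelled L X).encard z ≤ (labelled L Y).encard := by
  classical
  rcases Nat.eq_zero_or_pos z with rfl | hz
  · simp
  rcases (labelled L X).eq_empty_or_nonempty with h0 | ⟨l₀, hl₀⟩
  · simp [h0]
  by_cases hbig : ∃ l ∈ labelled L X, ∃ p ∈ l, (z : ℕ∞) ≤ (X p.1).encard
  · obtain ⟨l, hl, p, hp, hpz⟩ := hbig
    -- Some letter that occurs has at least `z` labels. Varying the label of this letter alone gives
    -- at least `z` labellings.
    have hne : ∀ p' ∈ l, (Y p'.1).Nonempty := fun p' hp' =>
      (h p'.1).nonempty hz ⟨_, hl.2 p' hp'⟩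
    have hg : ∀ e, ∃ y, (Y e).Nonempty → y ∈ Y e := fun e => by
      by_cases he : (Y e).Nonempty
      · exact ⟨he.some, fun _ => he.some_mem⟩
      · exact ⟨Classical.arbitrary β, fun h => absurd h he⟩
    choose g hg using hg
    let F : β → List (E × β) := fun y =>
      l.map fun p' => (p'.1, if p'.1 = p.1 then y else g p'.1)
    have hF : F '' Y p.1 ⊆ labelled L Y := by
      rintro _ ⟨y, hy, rfl⟩
      refine ⟨?_, ?_⟩
      · have := hl.1
        simpa [F, Function.comp_def] using this
      · simp only [F, List.mem_map]
        rintro _ ⟨p', hp', rfl⟩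
        dsimp only
        split_ifs with h1
        · rw [h1]; exact hy
        · exact hg _ (hne p' hp')
    have hinj : Set.InjOn F (Y p.1) := by
      intro y _ y' _ hyy
      have := List.map_inj_left.1 hyy p hp
      simpa using this
    calc min (labelled L X).encard z ≤ z := min_le_right _ _
      _ ≤ (Y p.1).encard := (h p.1).le_encard le_rfl hpz
      _ = (F '' Y p.1).encard := hinj.encard_image.symm
      _ ≤ _ := Set.encard_le_encard hF
  · push Not at hbig
    -- All letters that occur have fewer than `z` labels, hence equally many on both sides.
    have hf : ∀ e, ∃ f : α → β, (∃ l ∈ labelled L X, ∃ p ∈ l, p.1 = e) →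
        Set.InjOn f (X e) ∧ Set.MapsTo f (X e) (Y e) := by
      intro e
      by_cases he : ∃ l ∈ labelled L X, ∃ p ∈ l, p.1 = e
      · obtain ⟨l, hl, p, hp, rfl⟩ := he
        have hlt := hbig l hl p hp
        have hfin : (X p.1).Finite := Set.finite_of_encard_le_coe hlt.le
        obtain ⟨f, hf1, hf2⟩ := hfin.exists_injOn_of_encard_le ((h p.1).encard_eq hlt).le
        exact ⟨f, fun _ => ⟨hf2, hf1⟩⟩
      · exact ⟨fun _ => Classical.arbitrary β, fun h => absurd h he⟩
    choose f hf using hf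
    let F : List (E × α) → List (E × β) := fun l => l.map fun p => (p.1, f p.1 p.2)
    have hinj : Set.InjOn F (labelled L X) := by
      have key : ∀ (l l' : List (E × α)), (∀ p ∈ l, (∃ l ∈ labelled L X, ∃ q ∈ l, q.1 = p.1) ∧
          p.2 ∈ X p.1) → (∀ p ∈ l', p.2 ∈ X p.1) → F l = F l' → l = l' := by
        intro l
        induction l with
        | nil =>
          intro l' _ _ h
          cases l' with
          | nil => rfl
          | cons => simp [F] at h
        | cons p l ih =>
          intro l' h1 h2 h3
          cases l' with
          | nil => simp [F] at h3
          | cons p' l' =>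
            simp only [F, List.map_cons, List.cons.injEq, Prod.mk.injEq] at h3
            obtain ⟨⟨h4, h5⟩, h6⟩ := h3
            have h7 := h1 p (List.mem_cons_self ..)
            have h8 := h2 p' (List.mem_cons_self ..)
            rw [← h4] at h5 h8
            rw [ih l' (fun q hq => h1 q (List.mem_cons_of_mem _ hq))
              (fun q hq => h2 q (List.mem_cons_of_mem _ hq)) h6,
              Prod.ext h4 ((hf p.1 h7.1).1 h7.2 h8 h5)]
      exact fun l hl l' hl' hll => key l l' (fun p hp => ⟨⟨l, hl, p, hp, rfl⟩, hl.2 p hp⟩) hl'.2 hll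
    have hsub : F '' labelled L X ⊆ labelled L Y := by
      rintro _ ⟨l, hl, rfl⟩
      refine ⟨by simpa [F, Function.comp_def] using hl.1, ?_⟩
      simp only [F, List.mem_map]
      rintro _ ⟨p, hp, rfl⟩
      exact (hf p.1 ⟨l, hl, p, hp, rfl⟩).2 (hl.2 p hp)
    calc min (labelled L X).encard z ≤ (labelled L X).encard := min_le_left _ _
      _ = (F '' labelled L X).encard := hinj.encard_image.symm
      _ ≤ (labelled L Y).encard := Set.encard_le_encard hsub

/-- The number of labelled words up to the threshold `z` depends only on the numbers of labels up
to `z`. -/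
theorem SameCount.labelled [Nonempty α] [Nonempty β] (L : Set (List E)) {X : E → Set α}
    {Y : E → Set β} (h : ∀ e, SameCount z (X e) (Y e)) :
    SameCount z (labelled L X) (labelled L Y) :=
  le_antisymm (le_min (encard_labelled_le L h) (min_le_right _ _))
    (le_min (encard_labelled_le L fun e => (h e).symm) (min_le_right _ _))

/-- The words `l₁ a l₂` with middle letter `a ∈ M`, where `l₁ ∈ X a` and `l₂ ∈ Y a`. -/
def spliced (M : Set α) (X Y : α → Set (List α)) : Set (List α) :=
  {l | ∃ l₁ a l₂, l = l₁ ++ a :: l₂ ∧ a ∈ M ∧ l₁ ∈ X a ∧ l₂ ∈ Y a}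

/-- The factorizations that define `spliced M X Y` are unique. -/
def UniqueSplice (M : Set α) (X Y : α → Set (List α)) : Prop :=
  ∀ a ∈ M, ∀ l₁ ∈ X a, ∀ l₂ ∈ Y a, ∀ b ∈ M, ∀ m₁ ∈ X b, ∀ m₂ ∈ Y b,
    l₁ ++ a :: l₂ = m₁ ++ b :: m₂ → l₁ = m₁ ∧ a = b ∧ l₂ = m₂

/-- A uniquely factorized word `l₁ a l₂` is the two-letter word `(false, a) (true, a)` whose
letters carry the labels `l₁` and `l₂`. -/
theorem encard_spliced {M : Set α} {X Y : α → Set (List α)} (h : UniqueSplice M X Y) :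
    (spliced M X Y).encard = (labelled ((fun a => [(false, a), (true, a)]) '' M)
      fun e : Bool × α => cond e.1 (Y e.2) (X e.2)).encard := by
  let F : List ((Bool × α) × List α) → List α := fun l =>
    l.flatMap fun p => cond p.1.1 (p.1.2 :: p.2) p.2
  have mem : ∀ l, l ∈ labelled ((fun a => [(false, a), (true, a)]) '' M)
      (fun e : Bool × α => cond e.1 (Y e.2) (X e.2)) ↔
      ∃ l₁ a l₂, l = [((false, a), l₁), ((true, a), l₂)] ∧ a ∈ M ∧ l₁ ∈ X a ∧ l₂ ∈ Y a := by
    intro l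
    constructor
    · rintro ⟨⟨a, ha, hl⟩, h2⟩
      obtain _ | ⟨⟨e, l₁⟩, _ | ⟨⟨e', l₂⟩, _ | _⟩⟩ := l <;> simp at hl
      obtain ⟨rfl, rfl⟩ := hl
      simp at h2
      exact ⟨l₁, a, l₂, rfl, ha, h2.1, h2.2⟩
    · rintro ⟨l₁, a, l₂, rfl, ha, h1, h2⟩
      exact ⟨⟨a, ha, rfl⟩, by simp [h1, h2]⟩
  have himg : spliced M X Y = F '' labelled ((fun a => [(false, a), (true, a)]) '' M)
      fun e : Bool × α => cond e.1 (Y e.2) (X e.2) := by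
    ext l
    simp only [Set.mem_image, mem]
    constructor
    · rintro ⟨l₁, a, l₂, rfl, h⟩
      exact ⟨_, ⟨l₁, a, l₂, rfl, h⟩, by simp [F]⟩
    · rintro ⟨_, ⟨l₁, a, l₂, rfl, h⟩, rfl⟩
      exact ⟨l₁, a, l₂, by simp [F], h⟩
  rw [himg, Set.InjOn.encard_image]
  intro l hl m hm hlm
  obtain ⟨l₁, a, l₂, rfl, ha, h1, h2⟩ := (mem l).1 hl
  obtain ⟨m₁, b, m₂, rfl, hb, h3, h4⟩ := (mem m).1 hm
  obtain ⟨rfl, rfl, rfl⟩ := h a ha l₁ h1 l₂ h2 b hb m₁ h3 m₂ h4 (by simpa [F] using hlm)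
  rfl

theorem SameCount.spliced {M : Set α} {X Y X' Y' : α → Set (List α)}
    (h : UniqueSplice M X Y) (h' : UniqueSplice M X' Y')
    (hX : ∀ a, SameCount z (X a) (X' a)) (hY : ∀ a, SameCount z (Y a) (Y' a)) :
    SameCount z (spliced M X Y) (spliced M X' Y') := by
  rw [SameCount, encard_spliced h, encard_spliced h']
  exact SameCount.labelled _ (by rintro ⟨_ | _, a⟩ <;> simp [hX, hY])

theorem SameCount.exists_injOn [Nonempty β] {ι : Type*} {S : Set α} {T : Set β}
    (h : SameCount z S T) {J : Finset ι} (hJ : J.card ≤ z) {f : ι → α} (hf : Set.InjOn f J)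
    (hfS : ∀ j ∈ J, f j ∈ S) : ∃ g : ι → β, Set.InjOn g J ∧ ∀ j ∈ J, g j ∈ T := by
  have h1 : (J : Set ι).encard ≤ T.encard := by
    refine h.le_encard (by rw [Set.encard_coe_eq_coe_finsetCard]; exact_mod_cast hJ) ?_
    rw [← hf.encard_image]
    exact Set.encard_le_encard (by rintro _ ⟨j, hj, rfl⟩; exact hfS j hj)
  obtain ⟨g, hg1, hg2⟩ := J.finite_toSet.exists_injOn_of_encard_le h1
  exact ⟨g, hg2, hg1⟩

end Counting

/-! ### Runs relative to a base stack -/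

namespace TwoPS

variable {Q : Type u} {A : Type v}

/-- A transition acting on a relative stack, i.e. the part of a 2-stack above some base stack. In
contrast to `TwoPS.Step`, deleting the only word above the base is possible and leads to the
empty relative stack, from which there is no further step. -/
inductive RelStep (N : TwoPS Q A) : N.Tr → Config Q A → Config Q A → Prop
  | push {q q' : Q} {a : A} {b : {b : A // b ≠ N.bot}} (h : (q, a, q', .push b) ∈ N.trans)
      (w : List A) (s : Stack2 A) :
      RelStep N (q, a, q', .push b) (q, (a :: w) :: s) (q', (b.1 :: a :: w) :: s)
  | clone {q q' : Q} {a : A} (h : (q, a, q', .clone2) ∈ N.trans) (w : List A) (s : Stack2 A) :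
      RelStep N (q, a, q', .clone2) (q, (a :: w) :: s) (q', (a :: w) :: (a :: w) :: s)
  | pop1 {q q' : Q} {a : A} (h : (q, a, q', .pop1) ∈ N.trans) (w : List A) (hw : w ≠ [])
      (s : Stack2 A) : RelStep N (q, a, q', .pop1) (q, (a :: w) :: s) (q', w :: s)
  | pop2 {q q' : Q} {a : A} (h : (q, a, q', .pop2) ∈ N.trans) (w : List A) (s : Stack2 A) :
      RelStep N (q, a, q', .pop2) (q, (a :: w) :: s) (q', s)

/-- `N.Path P c l d`: the transition word `l` leads from the relative configuration `c` to `d`,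
and all stacks except possibly that of `d` satisfy `P`. -/
def Path (N : TwoPS Q A) (P : Stack2 A → Prop) : Config Q A → List N.Tr → Config Q A → Prop
  | c, [], d => c = d
  | c, δ :: l, d => P c.2 ∧ ∃ e, N.RelStep δ c e ∧ N.Path P e l d

variable {N : TwoPS Q A} {P P' : Stack2 A → Prop} {c d e : Config Q A} {l l₁ l₂ : List N.Tr}
  {δ : N.Tr}

theorem RelStep.det (h : N.RelStep δ c d) (h' : N.RelStep δ c e) : d = e := by
  cases h <;> cases h' <;> rfl

theorem RelStep.fst_eq (h : N.RelStep δ c d) : c.1 = δ.1 ∧ d.1 = δ.2.2.1 := by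
  cases h <;> exact ⟨rfl, rfl⟩

theorem RelStep.ne_nil (h : N.RelStep δ c d) : c.2 ≠ [] := by
  cases h <;> simp

theorem RelStep.append {q q' : Q} {s s' : Stack2 A} (h : N.RelStep δ (q, s) (q', s'))
    (r : Stack2 A) : N.RelStep δ (q, s ++ r) (q', s' ++ r) := by
  cases h with
  | push h => exact .push h ..
  | clone h => exact .clone h ..
  | pop1 h _ hw => exact .pop1 h _ hw _
  | pop2 h => exact .pop2 h ..

theorem RelStep.of_append {q : Q} {s r : Stack2 A} (h : N.RelStep δ (q, s ++ r) e) (hs : s ≠ []) :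
    ∃ s', e.2 = s' ++ r ∧ N.RelStep δ (q, s) (e.1, s') := by
  obtain ⟨x, s, rfl⟩ := List.exists_cons_of_ne_nil hs
  cases h with
  | push h w => exact ⟨(_ :: _ :: w) :: s, rfl, .push h ..⟩
  | clone h w => exact ⟨(_ :: w) :: (_ :: w) :: s, rfl, .clone h ..⟩
  | pop1 h w hw => exact ⟨w :: s, rfl, .pop1 h _ hw _⟩
  | pop2 h => exact ⟨s, rfl, .pop2 h ..⟩

theorem RelStep.words_ne_nil (h : N.RelStep δ c d) (hc : ∀ w ∈ c.2, w ≠ []) :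
    ∀ w ∈ d.2, w ≠ [] := by
  cases h with
  | push h => simpa using hc
  | clone h => simpa using hc
  | pop1 h _ hw => simpa [hw] using hc
  | pop2 h => simpa using hc

theorem path_append : N.Path P c (l₁ ++ l₂) d ↔ ∃ e, N.Path P c l₁ e ∧ N.Path P e l₂ d := by
  induction l₁ generalizing c with
  | nil => simp [Path]
  | cons δ l₁ ih =>
    simp only [List.cons_append, Path, ih]
    constructor
    · rintro ⟨h, e, h1, f, h2, h3⟩
      exact ⟨f, ⟨h, e, h1, h2⟩, h3⟩
    · rintro ⟨f, ⟨h, e, h1, h2⟩, h3⟩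
      exact ⟨h, e, h1, f, h2, h3⟩

theorem Path.det (h : N.Path P c l d) (h' : N.Path P' c l e) : d = e := by
  induction l generalizing c with
  | nil => exact h.symm.trans h'
  | cons δ l ih =>
    obtain ⟨-, x, h1, h2⟩ := h
    obtain ⟨-, y, h3, h4⟩ := h'
    obtain rfl := h1.det h3
    exact ih h2 h4

theorem Path.mono (hP : ∀ s, P s → P' s) (h : N.Path P c l d) : N.Path P' c l d := by
  induction l generalizing c with
  | nil => exact h
  | cons δ l ih =>
    obtain ⟨h0, x, h1, h2⟩ := h
    exact ⟨hP _ h0, x, h1, ih h2⟩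

/-- The trivial condition on stacks. -/
abbrev anyStack : Stack2 A → Prop := fun _ => True

theorem Path.any (h : N.Path P c l d) : N.Path anyStack c l d := h.mono fun _ _ => trivial

theorem Path.words_ne_nil (h : N.Path P c l d) (hc : ∀ w ∈ c.2, w ≠ []) :
    ∀ w ∈ d.2, w ≠ [] := by
  induction l generalizing c with
  | nil => rwa [← (h : c = d)]
  | cons δ l ih =>
    obtain ⟨-, x, h1, h2⟩ := h
    exact ih h2 (h1.words_ne_nil hc)

theorem Path.of_nil {q : Q} (h : N.Path P (q, []) l d) : l = [] ∧ d = (q, []) := by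
  cases l with
  | nil => exact ⟨rfl, h.symm⟩
  | cons δ l =>
    obtain ⟨-, x, h1, -⟩ := h
    exact absurd rfl h1.ne_nil

/-- A path can be carried out on top of further words `r`. All its stacks except possibly the
last are nonempty, so the new stacks before the last are proper extensions of `r`. -/
theorem Path.append_stack {q q' : Q} {s s' : Stack2 A} (h : N.Path P' (q, s) l (q', s'))
    {r : Stack2 A} (hP : ∀ s₁, s₁ ≠ [] → P (s₁ ++ r)) :
    N.Path P (q, s ++ r) l (q', s' ++ r) := by
  induction l generalizing q s with
  | nil =>
    obtain ⟨rfl, rfl⟩ := Prod.ext_iff.1 (h : (q, s) = (q', s'))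
    rfl
  | cons δ l ih =>
    obtain ⟨-, x, h1, h2⟩ := h
    exact ⟨hP _ h1.ne_nil, _, h1.append r, ih h2⟩

/-- A path that starts above `r` and ends no higher than `r` has to reach `r`; it is cut at the
first time it does so. -/
theorem Path.split_return {q : Q} {s r : Stack2 A} (h : N.Path P (q, s ++ r) l d)
    (hd : d.2.length ≤ r.length) : ∃ l₁ l₂ q', l = l₁ ++ l₂ ∧
      N.Path anyStack (q, s) l₁ (q', []) ∧ N.Path P (q', r) l₂ d := by
  induction l generalizing q s with
  | nil =>
    have h' : (q, s ++ r) = d := h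
    subst h'
    obtain rfl : s = [] := by simpa using hd
    exact ⟨[], [], q, rfl, rfl, rfl⟩
  | cons δ l ih =>
    rcases eq_or_ne s [] with rfl | hs
    · exact ⟨[], δ :: l, q, rfl, rfl, h⟩
    · obtain ⟨-, ⟨q₁, s₁⟩, h1, h2⟩ := h
      obtain ⟨s', rfl, h3⟩ := h1.of_append hs
      obtain ⟨l₁, l₂, q', rfl, h4, h5⟩ := ih h2
      exact ⟨δ :: l₁, l₂, q', rfl, ⟨trivial, _, h3, h4⟩, h5⟩

/-- The transition words of the returns with topmost word `w`. -/
def relReturns (N : TwoPS Q A) (w : List A) (q q' : Q) : Set (List N.Tr) :=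
  {l | N.Path anyStack (q, [w]) l (q', [])}

/-- The transition words of the runs that start with topmost word `w` and end with topmost word
`y` at the same width, without going below that width. For `w = y` these are the loops. -/
def relRuns (N : TwoPS Q A) (w y : List A) (q q' : Q) : Set (List N.Tr) :=
  {l | N.Path anyStack (q, [w]) l (q', [y])}

/-- The transition words of the high loops with topmost word `a :: v`. -/
def relHighLoops (N : TwoPS Q A) (a : A) (v : List A) (q q' : Q) : Set (List N.Tr) :=
  {l | N.Path (· ≠ [v]) (q, [a :: v]) l (q', [a :: v])}

/-- The transitions that pop the letter `a` of the topmost word. -/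
def popTrans (N : TwoPS Q A) (a : A) : Set N.Tr :=
  {δ | δ ∈ N.trans ∧ δ.2.1 = a ∧ δ.2.2.2 = .pop1}

/-- The transitions that push the letter `a` onto the topmost word `v`. -/
def pushTrans (N : TwoPS Q A) (v : List A) (a : A) : Set N.Tr :=
  {δ | δ ∈ N.trans ∧ v.head? = some δ.2.1 ∧ ∃ h, δ.2.2.2 = .push ⟨a, h⟩}

theorem relStep_of_mem_popTrans {a : A} (h : δ ∈ N.popTrans a) {v : List A} (hv : v ≠ [])
    (s : Stack2 A) : N.RelStep δ (δ.1, (a :: v) :: s) (δ.2.2.1, v :: s) := by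
  obtain ⟨q, a', q', op⟩ := δ
  obtain ⟨h1, rfl, rfl⟩ := h
  exact .pop1 h1 v hv s

theorem relStep_of_mem_pushTrans {a : A} {v : List A} (h : δ ∈ N.pushTrans v a)
    (s : Stack2 A) : N.RelStep δ (δ.1, v :: s) (δ.2.2.1, (a :: v) :: s) := by
  obtain ⟨q, a', q', op⟩ := δ
  obtain ⟨h1, h2, h3, rfl⟩ := h
  obtain ⟨b, v, rfl⟩ : ∃ b v', v = b :: v' := by
    cases v with
    | nil => simp at h2
    | cons b v' => exact ⟨b, v', rfl⟩
  obtain rfl : b = a' := by simpa using h2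
  exact .push h1 v s

/-- The bottom word of the relative stack `s` exists and has suffix `x`. -/
def Over (x : List A) (s : Stack2 A) : Prop := ∃ y ∈ s.getLast?, x <:+ y

theorem over_singleton {x y : List A} : Over x [y] ↔ x <:+ y := by simp [Over]

theorem over_cons_cons {x y y' : List A} {s : Stack2 A} :
    Over x (y :: y' :: s) ↔ Over x (y' :: s) := by
  simp [Over, List.getLast?_cons_cons]

theorem not_over_tail (a : A) (v : List A) : ¬ Over (a :: v) [v] := by
  rw [over_singleton]
  exact fun h => by simpa using h.length_le

/-- The only exit from the region over `a :: v` other than deleting the last word is popping `a`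
from the stack `[a :: v]`. -/
theorem RelStep.exit {a : A} {v : List A} (h : N.RelStep δ c d) (hc : Over (a :: v) c.2)
    (hd : ¬ Over (a :: v) d.2) (hd' : d.2 ≠ []) :
    c.2 = [a :: v] ∧ d.2 = [v] ∧ δ ∈ N.popTrans a := by
  cases h with
  | push h w s =>
    cases s with
    | nil =>
      rw [over_singleton] at hc hd
      exact absurd (hc.trans (List.suffix_cons _ _)) hd
    | cons => exact absurd (by simpa only [over_cons_cons] using hc) hd
  | clone h w s =>
    exact absurd (by simpa only [over_cons_cons] using hc) hd
  | pop1 h w hw s =>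
    cases s with
    | nil =>
      rw [over_singleton] at hc hd
      rcases List.suffix_cons_iff.1 hc with h1 | h1
      · obtain ⟨rfl, rfl⟩ := List.cons.inj h1
        exact ⟨rfl, rfl, h, rfl, rfl⟩
      · exact absurd h1 hd
    | cons => exact absurd (by simpa only [over_cons_cons] using hc) hd
  | pop2 h w s =>
    cases s with
    | nil => exact absurd rfl hd'
    | cons => exact absurd (by simpa only [over_cons_cons] using hc) hd

/-- The only entrance to the region over `a :: v` is pushing `a` onto the stack `[v]`. -/
theorem RelStep.enter {a : A} {v : List A} (h : N.RelStep δ c d) (hc : ¬ Over (a :: v) c.2)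
    (hd : Over (a :: v) d.2) : c.2 = [v] ∧ d.2 = [a :: v] ∧ δ ∈ N.pushTrans v a := by
  cases h with
  | @push _ _ a' b h w s =>
    cases s with
    | nil =>
      rw [over_singleton] at hc hd
      rcases List.suffix_cons_iff.1 hd with h1 | h1
      · obtain ⟨rfl, rfl⟩ := List.cons.inj h1
        exact ⟨rfl, rfl, h, rfl, b.2, rfl⟩
      · exact absurd h1 hc
    | cons => exact absurd (by simpa only [over_cons_cons] using hd) hc
  | clone h w s =>
    exact absurd (by simpa only [over_cons_cons] using hd) hc
  | pop1 h w hw s =>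
    cases s with
    | nil =>
      rw [over_singleton] at hc hd
      exact absurd (hd.trans (List.suffix_cons _ _)) hc
    | cons => exact absurd (by simpa only [over_cons_cons] using hd) hc
  | pop2 h w s =>
    cases s with
    | nil => simp [Over] at hd
    | cons => exact absurd (by simpa only [over_cons_cons] using hd) hc

/-- A path from the region over `a :: v` stays there, or is cut where it leaves the region for
the first time. Staying in the region amounts to avoiding the stack `[v]`. -/
theorem Path.exit {a : A} {v : List A} (h : N.Path anyStack c l d) (hc : Over (a :: v) c.2)
    (hd : d.2 ≠ []) : (N.Path (· ≠ [v]) c l d ∧ Over (a :: v) d.2) ∨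
      ∃ l₁ δ l₂, l = l₁ ++ δ :: l₂ ∧ δ ∈ N.popTrans a ∧
        N.Path (· ≠ [v]) c l₁ (δ.1, [a :: v]) ∧ N.Path anyStack (δ.2.2.1, [v]) l₂ d := by
  induction l generalizing c with
  | nil =>
    have h' : c = d := h
    subst h'
    exact .inl ⟨rfl, hc⟩
  | cons δ l ih =>
    obtain ⟨-, e, h1, h2⟩ := h
    have hcv : c.2 ≠ [v] := fun h => not_over_tail a v (h ▸ hc)
    by_cases he : Over (a :: v) e.2
    · rcases ih h2 he with ⟨h3, h4⟩ | ⟨l₁, δ', l₂, rfl, h3, h4, h5⟩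
      · exact .inl ⟨⟨hcv, e, h1, h3⟩, h4⟩
      · exact .inr ⟨δ :: l₁, δ', l₂, rfl, h3, ⟨hcv, e, h1, h4⟩, h5⟩
    · have he0 : e.2 ≠ [] := by
        rintro he0
        obtain ⟨q, s⟩ := e
        obtain rfl : s = [] := he0
        exact hd (by rw [h2.of_nil.2])
      obtain ⟨h3, h4, h5⟩ := h1.exit hc he he0
      obtain ⟨h6, h7⟩ := h1.fst_eq
      refine .inr ⟨[], δ, l, rfl, h5, Prod.ext h6 h3, ?_⟩
      rwa [show (δ.2.2.1, [v]) = e from (Prod.ext h7 h4).symm]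

/-- A path into the region over `a :: v` is cut where it enters the region for the last time. -/
theorem Path.enter {a : A} {v : List A} (h : N.Path anyStack c l d) (hc : ¬ Over (a :: v) c.2)
    (hd : Over (a :: v) d.2) : ∃ l₁ δ l₂, l = l₁ ++ δ :: l₂ ∧ δ ∈ N.pushTrans v a ∧
      N.Path anyStack c l₁ (δ.1, [v]) ∧ N.Path (· ≠ [v]) (δ.2.2.1, [a :: v]) l₂ d := by
  induction hn : l.length using Nat.strong_induction_on generalizing l c with
  | _ n ih =>
  cases l with
  | nil =>
    have h' : c = d := h
    exact absurd (h' ▸ hd) hc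
  | cons δ l =>
    obtain ⟨-, e, h1, h2⟩ := h
    have key : ∀ {m c'}, m.length < n → N.Path anyStack c' m d → ¬ Over (a :: v) c'.2 →
        ∀ l₀, N.Path anyStack c l₀ c' → δ :: l = l₀ ++ m →
        ∃ l₁ δ' l₂, δ :: l = l₁ ++ δ' :: l₂ ∧ δ' ∈ N.pushTrans v a ∧
          N.Path anyStack c l₁ (δ'.1, [v]) ∧ N.Path (· ≠ [v]) (δ'.2.2.1, [a :: v]) l₂ d := by
      intro m c' hm hp hc' l₀ hl₀ hl
      obtain ⟨l₁, δ', l₂, rfl, h3, h4, h5⟩ := ih _ hm hp hc' rfl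
      exact ⟨l₀ ++ l₁, δ', l₂, by simp [hl], h3, path_append.2 ⟨_, hl₀, h4⟩, h5⟩
    by_cases he : Over (a :: v) e.2
    · have hd0 : d.2 ≠ [] := fun h0 => by simp [h0, Over] at hd
      rcases h2.exit he hd0 with ⟨h3, -⟩ | ⟨l₁, δ', l₂, rfl, h3, h4, h5⟩
      · obtain ⟨h4, h5, h6⟩ := h1.enter hc he
        obtain ⟨h7, h8⟩ := h1.fst_eq
        refine ⟨[], δ, l, rfl, h6, Prod.ext h7 h4, ?_⟩
        rwa [show (δ.2.2.1, [a :: v]) = e from (Prod.ext h8 h5).symm]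
      · have hv : v ≠ [] := by
          rintro rfl
          cases l₂ with
          | nil =>
            rw [← show _ = d from h5] at hd
            exact not_over_tail a [] hd
          | cons δ'' l₂ =>
            obtain ⟨-, _, h6, -⟩ := h5
            cases h6
        refine key (by simp at hn; omega) h5 (not_over_tail a v) (δ :: (l₁ ++ [δ']))
          ⟨trivial, e, h1, path_append.2 ⟨_, h4.any, trivial, _,
            relStep_of_mem_popTrans h3 hv _, rfl⟩⟩ (by simp)
    · exact key (by simp at hn; omega) h2 he [δ] ⟨trivial, e, h1, rfl⟩ rfl

/-- The cut at the first visit of `[v]` is unique. -/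
theorem uniqueSplice_pop {a : A} {v : List A} (hv : v ≠ []) (q : Q) (Y : N.Tr → Set (List N.Tr)) :
    UniqueSplice (N.popTrans a) (fun δ => N.relHighLoops a v q δ.1) Y := by
  have key : ∀ δ ∈ N.popTrans a, ∀ l₁ ∈ N.relHighLoops a v q δ.1, ∀ δ' m,
      l₁ ++ δ :: m ∉ N.relHighLoops a v q δ' := by
    intro δ hδ l₁ h1 δ' m h
    obtain ⟨e, h2, -, f, h3, h4⟩ := path_append.1 h
    obtain rfl := h2.det h1
    obtain rfl := h3.det (relStep_of_mem_popTrans hδ hv [])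
    cases m with
    | nil => simp [Path] at h4
    | cons => exact h4.1 rfl
  intro δ hδ l₁ h1 l₂ _ δ' hδ' m₁ h3 m₂ _ heq
  rcases List.append_eq_append_iff.1 heq with ⟨m, h5, h6⟩ | ⟨m, h5, h6⟩
  · cases m with
    | nil => simp_all
    | cons x m =>
      obtain ⟨rfl, -⟩ := List.cons.inj h6
      exact absurd (h5 ▸ h3) (key _ hδ _ h1 _ _)
  · cases m with
    | nil => simp_all
    | cons x m =>
      obtain ⟨rfl, -⟩ := List.cons.inj h6
      exact absurd (h5 ▸ h1) (key _ hδ' _ h3 _ _)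

/-- The cut at the last visit of `[v]` is unique. -/
theorem uniqueSplice_push {a : A} {v w : List A} (q q' : Q) :
    UniqueSplice (N.pushTrans v a) (fun δ => N.relRuns w v q δ.1)
      (fun δ => N.relHighLoops a v δ.2.2.1 q') := by
  have key : ∀ δ ∈ N.pushTrans v a, ∀ l₁ ∈ N.relRuns w v q δ.1,
      ∀ δ' m l₂, l₁ ++ δ :: m ∈ N.relRuns w v q δ' →
      m ++ l₂ ∈ N.relHighLoops a v δ.2.2.1 q' → l₂ = [] := by
    intro δ hδ l₁ h1 δ' m l₂ h h'
    obtain ⟨e, h2, -, f, h3, h4⟩ := path_append.1 h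
    obtain rfl := h2.det h1
    obtain rfl := h3.det (relStep_of_mem_pushTrans hδ [])
    obtain ⟨g, h5, h6⟩ := path_append.1 h'
    obtain rfl := h5.det h4
    cases l₂ with
    | nil => rfl
    | cons => exact absurd rfl h6.1
  intro δ hδ l₁ h1 l₂ h2 δ' hδ' m₁ h3 m₂ h4 heq
  rcases List.append_eq_append_iff.1 heq with ⟨m, h5, h6⟩ | ⟨m, h5, h6⟩
  · cases m with
    | nil => simp_all
    | cons x m =>
      obtain ⟨rfl, h7⟩ := List.cons.inj h6
      exact absurd (key _ hδ _ h1 _ _ _ (h5 ▸ h3) (h7 ▸ h2)) (by simp)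
  · cases m with
    | nil => simp_all
    | cons x m =>
      obtain ⟨rfl, h7⟩ := List.cons.inj h6
      exact absurd (key _ hδ' _ h3 _ _ _ (h5 ▸ h1) (h7 ▸ h4)) (by simp)

theorem spliced_pop_subset {a : A} {v y : List A} (hv : v ≠ []) (q q' : Q) :
    spliced (N.popTrans a) (fun δ => N.relHighLoops a v q δ.1)
      (fun δ => N.relRuns v y δ.2.2.1 q') ⊆ N.relRuns (a :: v) y q q' := by
  rintro _ ⟨l₁, δ, l₂, rfl, h1, h2, h3⟩
  exact path_append.2 ⟨_, h2.any, trivial, _, relStep_of_mem_popTrans h1 hv [], h3⟩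

theorem relRuns_cons_left {a : A} {v y : List A} (hv : v ≠ []) (hy : ¬ a :: v <:+ y) (q q' : Q) :
    N.relRuns (a :: v) y q q' = spliced (N.popTrans a) (fun δ => N.relHighLoops a v q δ.1)
      (fun δ => N.relRuns v y δ.2.2.1 q') := by
  refine Set.Subset.antisymm (fun l hl => ?_) (spliced_pop_subset hv q q')
  rcases hl.exit (over_singleton.2 (List.suffix_refl (a :: v))) (by simp) with ⟨-, h⟩ | h
  · exact absurd (over_singleton.1 h) hy
  · exact h

theorem relRuns_cons_self {a : A} {v : List A} (hv : v ≠ []) (q q' : Q) :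
    N.relRuns (a :: v) (a :: v) q q' = N.relHighLoops a v q q' ∪
      spliced (N.popTrans a) (fun δ => N.relHighLoops a v q δ.1)
        (fun δ => N.relRuns v (a :: v) δ.2.2.1 q') := by
  refine Set.Subset.antisymm (fun l hl => ?_)
    (Set.union_subset (fun l hl => hl.any) (spliced_pop_subset hv q q'))
  rcases hl.exit (over_singleton.2 (List.suffix_refl (a :: v))) (by simp) with ⟨h, -⟩ | h
  · exact .inl h
  · exact .inr h

theorem disjoint_relHighLoops_spliced {a : A} {v : List A} (hv : v ≠ []) (q q' : Q) :
    Disjoint (N.relHighLoops a v q q')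
      (spliced (N.popTrans a) (fun δ => N.relHighLoops a v q δ.1)
        (fun δ => N.relRuns v (a :: v) δ.2.2.1 q')) := by
  rw [Set.disjoint_left]
  rintro _ h ⟨l₁, δ, l₂, rfl, h1, h2, h3⟩
  obtain ⟨e, h4, -, f, h5, h6⟩ := path_append.1 h
  obtain rfl := h4.det h2
  obtain rfl := h5.det (relStep_of_mem_popTrans h1 hv [])
  cases l₂ with
  | nil => simp [Path] at h6
  | cons => exact h6.1 rfl

theorem relRuns_cons_right {a : A} {w y : List A} (hw : ¬ a :: y <:+ w) (q q' : Q) :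
    N.relRuns w (a :: y) q q' = spliced (N.pushTrans y a) (fun δ => N.relRuns w y q δ.1)
      (fun δ => N.relHighLoops a y δ.2.2.1 q') := by
  refine Set.Subset.antisymm (fun l hl => ?_) ?_
  · exact hl.enter (fun h => hw (over_singleton.1 h)) (over_singleton.2 (List.suffix_refl _))
  · rintro _ ⟨l₁, δ, l₂, rfl, h1, h2, h3⟩
    exact path_append.2 ⟨_, h2, trivial, _, relStep_of_mem_pushTrans h1 [], h3.any⟩

end TwoPS

/-! ### Dependence of returns and high loops on the word below -/

namespace TwoPS

variable {Q : Type u} {A : Type v}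

/-- A step on relative stacks over a symbolic word `v`, where each word `x` of the stack stands
for `x ++ v`. Either a transition is carried out that does not uncover a copy of `v`, or the last
letter of `x` is popped and the copy of `v` is disposed of by an unspecified return, ending in
the given state. -/
inductive ItemStep (N : TwoPS Q A) : N.Tr × Option Q → Config Q A → Config Q A → Prop
  | plain {δ : N.Tr} {c d : Config Q A} (h : N.RelStep δ c d) : ItemStep N (δ, none) c d
  | jump {q q₁ : Q} {a : A} (h : (q, a, q₁, .pop1) ∈ N.trans) (q₂ : Q) (s : Stack2 A) :
      ItemStep N ((q, a, q₁, .pop1), some q₂) (q, [a] :: s) (q₂, s)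

/-- Paths consisting of steps over a symbolic word. -/
def ItemPath (N : TwoPS Q A) : Config Q A → List (N.Tr × Option Q) → Config Q A → Prop
  | c, [], d => c = d
  | c, i :: l, d => ∃ e, N.ItemStep i c e ∧ N.ItemPath e l d

/-- The transition words that an item leaves unspecified: nothing for a plain transition, and the
returns of `v` between the two given states for a jump. -/
def itemLabels (N : TwoPS Q A) (v : List A) : N.Tr × Option Q → Set (List N.Tr)
  | (_, none) => {[]}
  | (δ, some q) => N.relReturns v δ.2.2.1 q

/-- The transition word obtained by filling in the returns of `v`. -/
def expand (N : TwoPS Q A) (m : List ((N.Tr × Option Q) × List N.Tr)) : List N.Tr :=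
  m.flatMap fun p => p.1.1 :: p.2

variable {N : TwoPS Q A} {v : List A} {c d e : Config Q A}

theorem relReturns_nil (q q' : Q) : N.relReturns [] q q' = ∅ := by
  rw [Set.eq_empty_iff_forall_notMem]
  rintro (_ | ⟨δ, l⟩) h
  · simp [relReturns, Path] at h
  · obtain ⟨-, _, h1, -⟩ := h
    cases h1

theorem ItemPath.of_nil {q : Q} {l : List (N.Tr × Option Q)} (h : N.ItemPath (q, []) l d) :
    d = (q, []) := by
  cases l with
  | nil => exact h.symm
  | cons i l =>
    obtain ⟨x, h1, -⟩ := h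
    cases h1 with
    | plain h => exact absurd rfl h.ne_nil

/-- The actual relative configuration represented by one over the symbolic word `v`. -/
abbrev raise (v : List A) (c : Config Q A) : Config Q A := (c.1, c.2.map (· ++ v))

theorem RelStep.raise {δ : N.Tr} (h : N.RelStep δ c d) : N.RelStep δ (raise v c) (raise v d) := by
  cases h with
  | push h => exact .push h ..
  | clone h => exact .clone h ..
  | pop1 h w hw => exact .pop1 h _ (by simp [hw]) _
  | pop2 h => exact .pop2 h ..

/-- Filling in returns of `v` gives a path; it avoids `[v]` unless it ends with the empty stack. -/
theorem ItemPath.path {m : List ((N.Tr × Option Q) × List N.Tr)}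
    (h : N.ItemPath c (m.map Prod.fst) d) (hm : ∀ p ∈ m, p.2 ∈ N.itemLabels v p.1)
    (hc : ∀ x ∈ c.2, x ≠ []) :
    N.Path (fun s => d.2 = [] ∨ s ≠ [v]) (raise v c) (N.expand m) (raise v d) := by
  induction m generalizing c with
  | nil =>
    obtain rfl : c = d := h
    rfl
  | cons p m ih =>
    obtain ⟨i, r⟩ := p
    obtain ⟨e, h1, h2⟩ := h
    have hr := hm _ (List.mem_cons_self ..)
    have hm' : ∀ p ∈ m, p.2 ∈ N.itemLabels v p.1 := fun p hp => hm p (List.mem_cons_of_mem _ hp)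
    have hcv : ∀ s : Stack2 A, (∀ x ∈ s, x ≠ []) → s.map (· ++ v) ≠ [v] := by
      intro s hs heq
      obtain ⟨x, rfl⟩ : ∃ x, s = [x] := by
        rw [← List.length_eq_one_iff]
        simpa using congrArg List.length heq
      simp at heq
      exact hs x (by simp) heq
    cases h1 with
    | @plain δ _ _ h1 =>
      obtain rfl : r = [] := hr
      exact ⟨.inr (hcv _ hc), _, h1.raise, ih h2 hm' (h1.words_ne_nil hc)⟩
    | @jump q q₁ a h1 q₂ s =>
      have hv : v ≠ [] := by
        rintro rfl
        exact absurd (show r ∈ N.relReturns [] q₁ q₂ from hr) (by simp [relReturns_nil])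
      have hs : d.2 = [] ∨ s ≠ [] := by
        by_contra! hs
        obtain ⟨h3, rfl⟩ := hs
        exact h3 (by rw [h2.of_nil])
      refine ⟨.inr (hcv _ hc), _, .pop1 h1 _ (by simpa using hv) _, ?_⟩
      refine path_append.2 ⟨raise v (q₂, s), ?_, ih h2 hm' fun x hx => hc x (by simp [hx])⟩
      exact Path.append_stack (s := [v]) (s' := []) hr fun s₁ hs₁ => hs.imp_right fun hs => by
        intro heq
        have := congrArg List.length heq
        have h3 := List.length_pos_of_ne_nil hs
        have h4 := List.length_pos_of_ne_nil hs₁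
        simp at this
        omega

theorem map_append_injective (v : List A) : Function.Injective (List.map (· ++ v)) :=
  List.map_injective_iff.2 fun _ _ h => List.append_cancel_right h

/-- A path between stacks of words `x ++ v` with `x ≠ []` factors into plain transitions and
returns of copies of `v`. The hypothesis on the final stack excludes that a copy of `v` is left
on top of the base without being deleted. -/
theorem Path.exists_itemPath {P : Stack2 A → Prop} {l : List N.Tr}
    (h : N.Path P (raise v c) l (raise v d)) (hc : ∀ x ∈ c.2, x ≠ [])
    (hd : d.2 = [] ∨ ¬ P [v] ∧ ∃ x, x ≠ [] ∧ d.2 = [x]) :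
    ∃ m, N.expand m = l ∧ (∀ p ∈ m, p.2 ∈ N.itemLabels v p.1) ∧
      N.ItemPath c (m.map Prod.fst) d := by
  induction hn : l.length using Nat.strong_induction_on generalizing l c with
  | _ n ih =>
  obtain ⟨q, s⟩ := c
  cases l with
  | nil =>
    obtain ⟨h1, h2⟩ := Prod.ext_iff.1 (h : _ = _)
    exact ⟨[], rfl, by simp, Prod.ext h1 (map_append_injective v h2)⟩
  | cons δ l =>
    obtain ⟨-, e, h1, h2⟩ := h
    have plain : ∀ e', e = raise v e' → N.RelStep δ (q, s) e' → ∃ m, N.expand m = δ :: l ∧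
        (∀ p ∈ m, p.2 ∈ N.itemLabels v p.1) ∧ N.ItemPath (q, s) (m.map Prod.fst) d := by
      rintro e' rfl h3
      obtain ⟨m, rfl, h4, h5⟩ := ih l.length (by simp at hn; omega) h2 (h3.words_ne_nil hc) rfl
      exact ⟨((δ, none), []) :: m, rfl, by simpa [itemLabels] using h4, e', .plain h3, h5⟩
    cases s with
    | nil => exact absurd rfl h1.ne_nil
    | cons x s =>
      obtain ⟨b, x, rfl⟩ := List.exists_cons_of_ne_nil (hc x (List.mem_cons_self ..))
      cases h1 with
      | push h1 => exact plain (_, (_ :: _ :: x) :: s) rfl (.push h1 ..)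
      | clone h1 => exact plain (_, (_ :: x) :: (_ :: x) :: s) rfl (.clone h1 ..)
      | pop2 h1 => exact plain (_, s) rfl (.pop2 h1 ..)
      | @pop1 _ q' _ h1 _ hw =>
        -- Popping the single letter `b` uncovers a copy of `v`, which starts a return unless
        -- `b :: v` is the only word of the stack; the latter is possible only if the path ends with
        -- the empty stack.
        rcases eq_or_ne x [] with rfl | hx
        · have hlen : d.2.length ≤ s.length := by
            rcases hd with hd | ⟨hP, y, hy, hd⟩
            · simp [hd]
            · cases s with
              | nil =>
                cases l with
                | nil =>
                  have := congrArg Prod.snd (show _ = raise v d from h2)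
                  simp [hd, hy] at this
                | cons => exact absurd h2.1 hP
              | cons => simp [hd]
          obtain ⟨l₁, l₂, q₂, rfl, h3, h4⟩ := Path.split_return (s := [v]) h2 (by simpa using hlen)
          obtain ⟨m, rfl, h5, h6⟩ := ih l₂.length (by simp at hn; omega) (c := (q₂, s)) h4
            (fun x hx => hc x (List.mem_cons_of_mem _ hx)) rfl
          refine ⟨((_, some q₂), l₁) :: m, rfl, ?_, (q₂, s), .jump h1 q₂ s, h6⟩
          rintro p hp
          rcases List.mem_cons.1 hp with rfl | hp
          · exact h3
          · exact h5 p hp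
        · exact plain (_, x :: s) rfl (.pop1 h1 _ hx _)

/-- Returns form a prefix code, as the empty relative stack permits no step. -/
theorem relReturns_append_inj {q q₁ q₂ : Q} {r r' l l' : List N.Tr}
    (h : r ∈ N.relReturns v q q₁) (h' : r' ∈ N.relReturns v q q₂) (heq : r ++ l = r' ++ l') :
    r = r' ∧ q₁ = q₂ ∧ l = l' := by
  have key : ∀ {q₁ q₂ r m}, r ∈ N.relReturns v q q₁ → r ++ m ∈ N.relReturns v q q₂ → m = [] := by
    intro q₁ q₂ r m h1 h2
    obtain ⟨e, h3, h4⟩ := path_append.1 h2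
    obtain rfl := h3.det h1
    exact h4.of_nil.1
  have hr : r = r' := by
    rcases List.append_eq_append_iff.1 heq with ⟨m, h5, -⟩ | ⟨m, h5, -⟩
    · simpa [key h (h5 ▸ h')] using h5.symm
    · simpa [key h' (h5 ▸ h)] using h5
  subst hr
  exact ⟨rfl, (Prod.ext_iff.1 (Path.det h h')).1, List.append_cancel_left heq⟩

/-- The factorization into plain transitions and returns of `v` is unique. -/
theorem expand_inj {m m' : List ((N.Tr × Option Q) × List N.Tr)} {d' : Config Q A}
    (h : N.ItemPath c (m.map Prod.fst) d) (h' : N.ItemPath c (m'.map Prod.fst) d')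
    (hm : ∀ p ∈ m, p.2 ∈ N.itemLabels v p.1) (hm' : ∀ p ∈ m', p.2 ∈ N.itemLabels v p.1)
    (heq : N.expand m = N.expand m') : m = m' := by
  induction m generalizing c m' with
  | nil =>
    cases m' with
    | nil => rfl
    | cons => simp [expand] at heq
  | cons p m ih =>
    cases m' with
    | nil => simp [expand] at heq
    | cons p' m' =>
      obtain ⟨⟨δ, i⟩, r⟩ := p
      obtain ⟨⟨δ', i'⟩, r'⟩ := p'
      obtain ⟨e, h1, h2⟩ := h
      obtain ⟨e', h1', h2'⟩ := h'
      have hr := hm _ (List.mem_cons_self ..)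
      have hr' := hm' _ (List.mem_cons_self ..)
      have heq' : δ :: (r ++ N.expand m) = δ' :: (r' ++ N.expand m') := by
        simpa [expand] using heq
      obtain ⟨rfl, htail⟩ := List.cons.inj heq'
      have hmm := fun p hp => hm p (List.mem_cons_of_mem _ hp)
      have hmm' := fun p hp => hm' p (List.mem_cons_of_mem _ hp)
      cases h1 with
      | plain h1 =>
        cases h1' with
        | plain h1' =>
          obtain rfl := h1.det h1'
          obtain rfl : r = [] := hr
          obtain rfl : r' = [] := hr'
          rw [ih h2 h2' hmm hmm' htail]
        | jump h1' =>
          cases h1 with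
          | pop1 _ _ hw => exact absurd rfl hw
      | jump h1 =>
        cases h1' with
        | plain h1' =>
          cases h1' with
          | pop1 _ _ hw => exact absurd rfl hw
        | jump h1' =>
          obtain ⟨rfl, rfl, htail⟩ := relReturns_append_inj hr hr' htail
          rw [ih h2 h2' hmm hmm' htail]

/-- The item words leading from state `q` and the stack `[[a]]` to `d` over a symbolic word. -/
def itemPaths (N : TwoPS Q A) (a : A) (q : Q) (d : Config Q A) : Set (List (N.Tr × Option Q)) :=
  {l | N.ItemPath (q, [[a]]) l d}

theorem expand_injOn (a : A) (q : Q) :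
    Set.InjOn N.expand (labelled (N.itemPaths a q d) (N.itemLabels v)) :=
  fun _ hm _ hm' heq => expand_inj hm.1 hm'.1 hm.2 hm'.2 heq

theorem relReturns_cons (a : A) (v : List A) (q q' : Q) :
    N.relReturns (a :: v) q q' =
      N.expand '' labelled (N.itemPaths a q (q', [])) (N.itemLabels v) := by
  ext l
  constructor
  · intro h
    obtain ⟨m, h1, h2, h3⟩ :=
      Path.exists_itemPath (v := v) (c := (q, [[a]])) (d := (q', [])) h (by simp) (.inl rfl)
    exact ⟨m, ⟨h3, h2⟩, h1⟩
  · rintro ⟨m, ⟨h1, h2⟩, rfl⟩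
    exact (ItemPath.path h1 h2 (by simp)).any

theorem relHighLoops_eq (a : A) (v : List A) (q q' : Q) :
    N.relHighLoops a v q q' =
      N.expand '' labelled (N.itemPaths a q (q', [[a]])) (N.itemLabels v) := by
  ext l
  constructor
  · intro h
    obtain ⟨m, h1, h2, h3⟩ := Path.exists_itemPath (v := v) (c := (q, [[a]])) (d := (q', [[a]])) h
      (by simp) (.inr ⟨by simp, [a], by simp, rfl⟩)
    exact ⟨m, ⟨h3, h2⟩, h1⟩
  · rintro ⟨m, ⟨h1, h2⟩, rfl⟩
    exact (ItemPath.path h1 h2 (by simp)).mono fun s hs => by simpa using hs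

variable {z : ℕ} {v' : List A}

theorem sameCount_itemLabels
    (h : ∀ q q', SameCount z (N.relReturns v q q') (N.relReturns v' q q')) (i) :
    SameCount z (N.itemLabels v i) (N.itemLabels v' i) := by
  obtain ⟨δ, _ | q⟩ := i
  · exact SameCount.refl _
  · exact h _ _

theorem sameCount_relReturns_cons
    (h : ∀ q q', SameCount z (N.relReturns v q q') (N.relReturns v' q q')) (a : A) (q q' : Q) :
    SameCount z (N.relReturns (a :: v) q q') (N.relReturns (a :: v') q q') := by
  rw [SameCount, relReturns_cons, relReturns_cons, (expand_injOn a q).encard_image,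
    (expand_injOn a q).encard_image]
  exact SameCount.labelled _ (sameCount_itemLabels h)

theorem sameCount_relHighLoops
    (h : ∀ q q', SameCount z (N.relReturns v q q') (N.relReturns v' q q')) (a : A) (q q' : Q) :
    SameCount z (N.relHighLoops a v q q') (N.relHighLoops a v' q q') := by
  rw [SameCount, relHighLoops_eq, relHighLoops_eq, (expand_injOn a q).encard_image,
    (expand_injOn a q).encard_image]
  exact SameCount.labelled _ (sameCount_itemLabels h)

end TwoPS

/-! ### Runs and their transition words -/

namespace TwoPS

variable {Q : Type u} {A : Type v} {N : TwoPS Q A} {P : Stack2 A → Prop} {c d e : Config Q A}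
  {δ : N.Tr}

theorem Step.relStep {q : Q} {s t : Stack2 A} (h : N.Step δ (q, s ++ t) e) (hs : s ≠ []) :
    ∃ s', e.2 = s' ++ t ∧ N.RelStep δ (q, s) (e.1, s') := by
  obtain ⟨x, s, rfl⟩ := List.exists_cons_of_ne_nil hs
  obtain ⟨q₁, a, q₂, op⟩ := δ
  obtain ⟨q', s'⟩ := e
  obtain ⟨h1, h2, h3, h4, h5⟩ := h
  simp only at h2 h3 h4 h5
  subst h2 h4
  cases x with
  | nil => simp [Stack2.top1] at h3
  | cons b x =>
    obtain rfl : b = a := by simpa [Stack2.top1] using h3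
    cases op with
    | push b' =>
      obtain rfl : _ = s' := by simpa [StackOp.apply] using h5
      exact ⟨(_ :: _ :: x) :: s, rfl, .push h1 ..⟩
    | clone2 =>
      obtain rfl : _ = s' := by simpa [StackOp.apply] using h5
      exact ⟨(_ :: x) :: (_ :: x) :: s, rfl, .clone h1 ..⟩
    | pop1 =>
      cases x with
      | nil => simp [StackOp.apply] at h5
      | cons b' x =>
        obtain rfl : _ = s' := by simpa [StackOp.apply] using h5
        exact ⟨(_ :: x) :: s, rfl, .pop1 h1 _ (by simp) _⟩
    | pop2 =>
      refine ⟨s, ?_, .pop2 h1 ..⟩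
      cases hst : s ++ t with
      | nil => simp [StackOp.apply, hst] at h5
      | cons => simpa [StackOp.apply, hst, eq_comm] using h5

theorem RelStep.step {q q' : Q} {s s' t : Stack2 A} (h : N.RelStep δ (q, s) (q', s'))
    (ht : s' ++ t ≠ []) : N.Step δ (q, s ++ t) (q', s' ++ t) := by
  cases h with
  | push h => exact ⟨h, rfl, rfl, rfl, rfl⟩
  | clone h => exact ⟨h, rfl, rfl, rfl, rfl⟩
  | pop1 h w hw =>
    obtain ⟨b, w, rfl⟩ := List.exists_cons_of_ne_nil hw
    exact ⟨h, rfl, rfl, rfl, rfl⟩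
  | pop2 h w =>
    obtain ⟨x, r, hr⟩ := List.exists_cons_of_ne_nil ht
    refine ⟨h, rfl, rfl, rfl, ?_⟩
    simp [StackOp.apply, hr]

theorem Step.det (h : N.Step δ c d) (h' : N.Step δ c e) : d = e :=
  Prod.ext (h.2.2.2.1.trans h'.2.2.2.1.symm)
    (Option.some_injective _ (h.2.2.2.2.symm.trans h'.2.2.2.2))

theorem Step.ne_nil (h : N.Step δ c d) : d.2 ≠ [] := by
  obtain ⟨q, s⟩ := c
  rcases eq_or_ne s [] with rfl | hs
  · simp [Step, Stack2.top1] at h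
  intro hd
  obtain ⟨-, -, -, -, h⟩ := h
  rw [hd] at h
  revert h
  unfold StackOp.apply
  split <;> simp

theorem IsRun.path {q : Q} {s t : Stack2 A} {ms : List (N.Tr × Config Q A)}
    (h : N.IsRun (q, s ++ t) ms)
    (ht : ∀ x ∈ ((q, s ++ t) :: ms.map Prod.snd).dropLast, x.2 ≠ t)
    (hP : ∀ x ∈ ((q, s ++ t) :: ms.map Prod.snd).dropLast, ∀ s₁, x.2 = s₁ ++ t → P s₁)
    {q' : Q} {s' : Stack2 A}
    (hl : ((q, s ++ t) :: ms.map Prod.snd).getLast (List.cons_ne_nil _ _) = (q', s' ++ t)) :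
    N.Path P (q, s) (ms.map Prod.fst) (q', s') := by
  induction ms generalizing q s with
  | nil =>
    have hl : (q, s ++ t) = (q', s' ++ t) := hl
    obtain ⟨rfl, h2⟩ := Prod.ext_iff.1 hl
    obtain rfl := List.append_cancel_right h2
    rfl
  | cons p ms ih =>
    obtain ⟨δ, ⟨q₁, s₁⟩⟩ := p
    obtain ⟨h1, h2⟩ := h
    simp only [List.map_cons, List.dropLast_cons_cons, List.mem_cons, forall_eq_or_imp] at ht hP
    have hs : s ≠ [] := by
      rintro rfl
      exact ht.1 rfl
    obtain ⟨s₂, rfl, h3⟩ := h1.relStep hs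
    exact ⟨hP.1 _ rfl, _, h3, ih h2 ht.2 hP.2 (by simpa using hl)⟩

theorem Path.exists_isRun {q q' : Q} {s s' t : Stack2 A} {l : List N.Tr}
    (h : N.Path P (q, s) l (q', s')) (ht : s' ++ t ≠ []) :
    ∃ ms, N.IsRun (q, s ++ t) ms ∧ ms.map Prod.fst = l ∧
      ((q, s ++ t) :: ms.map Prod.snd).getLast (List.cons_ne_nil _ _) = (q', s' ++ t) ∧
      ∀ x ∈ ((q, s ++ t) :: ms.map Prod.snd).dropLast, ∃ s₁, s₁ ≠ [] ∧ x.2 = s₁ ++ t ∧ P s₁ := by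
  induction l generalizing q s with
  | nil =>
    obtain ⟨rfl, rfl⟩ := Prod.ext_iff.1 (h : (q, s) = (q', s'))
    exact ⟨[], trivial, rfl, rfl, by simp⟩
  | cons δ l ih =>
    obtain ⟨h0, ⟨q₁, s₁⟩, h1, h2⟩ := h
    have hs₁ : s₁ ++ t ≠ [] := by
      cases l with
      | nil =>
        obtain ⟨rfl, rfl⟩ := Prod.ext_iff.1 (h2 : (q₁, s₁) = (q', s'))
        exact ht
      | cons δ' l =>
        obtain ⟨-, x, h3, -⟩ := h2
        simpa using fun h => absurd h h3.ne_nil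
    obtain ⟨ms, h3, rfl, h4, h5⟩ := ih h2
    refine ⟨(δ, (q₁, s₁ ++ t)) :: ms, ⟨h1.step hs₁, h3⟩, rfl, by simpa using h4, ?_⟩
    simp only [List.map_cons, List.dropLast_cons_cons, List.mem_cons, forall_eq_or_imp]
    exact ⟨⟨s, h1.ne_nil, rfl, h0⟩, h5⟩

theorem isRun_det {ms ms' : List (N.Tr × Config Q A)} (h : N.IsRun c ms) (h' : N.IsRun c ms')
    (heq : ms.map Prod.fst = ms'.map Prod.fst) : ms = ms' := by
  induction ms generalizing c ms' with
  | nil => exact (List.map_eq_nil_iff.1 heq.symm).symm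
  | cons p ms ih =>
    cases ms' with
    | nil => simp at heq
    | cons p' ms' =>
      obtain ⟨δ, d⟩ := p
      obtain ⟨δ', d'⟩ := p'
      obtain ⟨h1, h2⟩ := h
      obtain ⟨h1', h2'⟩ := h'
      simp only [List.map_cons, List.cons.injEq] at heq
      obtain ⟨rfl, heq⟩ := heq
      obtain rfl := h1.det h1'
      rw [ih h2 h2' heq]

theorem IsRun.ne_nil {ms : List (N.Tr × Config Q A)} (h : N.IsRun c ms) (hc : c.2 ≠ []) :
    ∀ x ∈ c :: ms.map Prod.snd, x.2 ≠ [] := by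
  induction ms generalizing c with
  | nil => simpa using hc
  | cons p ms ih =>
    intro x hx
    rcases List.mem_cons.1 hx with rfl | hx
    · exact hc
    · exact ih h.2 h.1.ne_nil x hx

namespace Run

/-- The word of transitions of a run. -/
def word (ρ : N.Run) : List N.Tr := ρ.moves.map Prod.fst

/-- Transitions act deterministically, so a run is determined by its start and its transition
word. -/
theorem ext_word {ρ ρ' : N.Run} (hs : ρ.start = ρ'.start) (hw : ρ.word = ρ'.word) : ρ = ρ' := by
  obtain ⟨c, ms, h⟩ := ρ
  obtain ⟨c', ms', h'⟩ := ρ'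
  obtain rfl : c = c' := hs
  obtain rfl := isRun_det h h' hw
  rfl

end Run

theorem encard_runs_eq {R : Set N.Run} {S : Set (List N.Tr)} {c : Config Q A}
    (hs : ∀ ρ ∈ R, ρ.start = c) (hR : ∀ ρ ∈ R, ρ.word ∈ S) (hS : ∀ l ∈ S, ∃ ρ ∈ R, ρ.word = l) :
    R.encard = S.encard := by
  have : S = Run.word '' R :=
    Set.Subset.antisymm hS (by rintro _ ⟨ρ, hρ, rfl⟩; exact hR ρ hρ)
  rw [this, Set.InjOn.encard_image]
  exact fun ρ hρ ρ' hρ' h => Run.ext_word ((hs ρ hρ).trans (hs ρ' hρ').symm) h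

theorem encard_runs (w y : List A) (q q' : Q) :
    {ρ : N.Run | ρ.IsFromTo (q, [w]) (q', [y])}.encard = (N.relRuns w y q q').encard := by
  refine encard_runs_eq (fun ρ hρ => hρ.1) ?_ fun l hl => ?_
  · rintro ⟨c, ms, h⟩ ⟨rfl, hf⟩
    exact IsRun.path (s := [w]) (t := []) h
      (fun x hx => h.ne_nil (by simp) x (List.mem_of_mem_dropLast hx)) (fun _ _ _ _ => trivial) hf
  · obtain ⟨ms, h1, h2, h3, -⟩ := Path.exists_isRun (t := []) hl (by simp)
    exact ⟨⟨_, ms, h1⟩, ⟨rfl, h3⟩, h2⟩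

theorem encard_loops (w : List A) (q q' : Q) :
    (N.loops [] w q q').encard = (N.relRuns w w q q').encard := by
  rw [← encard_runs]
  congr 1
  ext ρ
  refine ⟨fun h => h.1, fun h => ⟨h, ?_⟩⟩
  obtain ⟨c, ms, hr⟩ := ρ
  obtain ⟨rfl, hf⟩ := h
  rintro ⟨x, hx, hx0⟩
  exact hr.ne_nil (by simp) x hx hx0

theorem encard_highLoops (a : A) {v : List A} (hv : v ≠ []) (q q' : Q) :
    (N.highLoops [] (a :: v) q q').encard = (N.relHighLoops a v q q').encard := by
  have hpop : (StackOp.pop1 : StackOp N.bot).apply [a :: v] = some [v] := by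
    obtain ⟨b, v, rfl⟩ := List.exists_cons_of_ne_nil hv
    rfl
  refine encard_runs_eq (fun ρ hρ => hρ.1.1.1) ?_ fun l hl => ?_
  · rintro ⟨c, ms, h⟩ ⟨⟨⟨rfl, hf⟩, h1⟩, h2⟩
    refine IsRun.path (s := [a :: v]) (t := []) h
      (fun x hx hx0 => h1 ⟨x, List.mem_of_mem_dropLast hx, hx0⟩) (fun x hx s hxs hs => ?_) hf
    exact h2 _ hpop ⟨x, List.mem_of_mem_dropLast hx, by rw [hxs, hs]; rfl⟩
  · obtain ⟨ms, h1, h2, h3, h4⟩ := Path.exists_isRun (t := []) hl (by simp)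
    refine ⟨⟨_, ms, h1⟩, ⟨⟨⟨rfl, h3⟩, ?_⟩, ?_⟩, h2⟩
    · rintro ⟨x, hx, hx0⟩
      exact h1.ne_nil (by simp) x hx hx0
    · intro s hs
      obtain rfl : [v] = s := Option.some_injective _ (hpop.symm.trans hs)
      rintro ⟨x, hx, hxv⟩
      have hx' : x ∈ (((q, [a :: v] ++ []) : Config Q A) :: ms.map Prod.snd).dropLast ++
          [(q', [a :: v] ++ [])] := by
        rw [← h3, List.dropLast_append_getLast]
        exact hx
      rcases List.mem_append.1 hx' with hx' | hx'
      · obtain ⟨s₁, -, h5, h6⟩ := h4 x hx'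
        exact h6 (by rw [← hxv, h5, List.append_nil])
      · obtain rfl := List.mem_singleton.1 hx'
        simp at hxv

theorem encard_returns (w : List A) (q q' : Q) :
    (N.returns [[N.bot]] w q q').encard = (N.relReturns w q q').encard := by
  refine encard_runs_eq (fun ρ hρ => hρ.1.1) ?_ fun l hl => ?_
  · rintro ⟨c, ms, h⟩ ⟨⟨rfl, hf⟩, h1⟩
    exact IsRun.path (s := [w]) (s' := []) (t := [[N.bot]]) h h1 (fun _ _ _ _ => trivial) hf
  · obtain ⟨ms, h1, h2, h3, h4⟩ := Path.exists_isRun (t := [[N.bot]]) hl (by simp)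
    refine ⟨⟨_, ms, h1⟩, ⟨⟨rfl, h3⟩, fun x hx hxb => ?_⟩, h2⟩
    obtain ⟨s₁, hs₁, h5, -⟩ := h4 x hx
    rw [hxb] at h5
    exact hs₁ (by simpa using h5)

theorem countUpTo_eq_iff {α β : Type*} {z : ℕ} {S : Set α} {T : Set β} :
    countUpTo z S = countUpTo z T ↔ SameCount z S T := by
  have h : ∀ a : ℕ∞, min a (z : ℕ∞) ≠ ⊤ := fun a =>
    ((min_le_right _ _).trans_lt (ENat.natCast_lt_top z)).ne
  rw [countUpTo, countUpTo, Fin.mk.injEq, SameCount]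
  exact ⟨fun h' => by rw [← ENat.natCast_toNat (h _), h', ENat.natCast_toNat (h _)],
    fun h' => by rw [h']⟩

/-- The transitions that duplicate the topmost word `w` in state `q`. -/
def cloneTrans (N : TwoPS Q A) (q : Q) (w : List A) : Set N.Tr :=
  {δ | δ ∈ N.trans ∧ δ.1 = q ∧ w.head? = some δ.2.1 ∧ δ.2.2.2 = .clone2}

theorem exists_clone_of_staysAbove {ρ : N.Run} {q p : Q} {w y : List A} {s : Stack2 A}
    (h : ρ.IsFromTo (q, w :: s) (p, y :: w :: s)) (h' : ρ.StaysAbove (w :: s).length) :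
    ∃ δ ∈ N.cloneTrans q w, ∃ l ∈ N.relRuns w y δ.2.2.1 p, ρ.word = δ :: l := by
  obtain ⟨c, ms, hr⟩ := ρ
  obtain ⟨rfl, hf⟩ := h
  cases ms with
  | nil =>
    have := congrArg (fun c : Config Q A => c.2.length) (show (q, w :: s) = _ from hf)
    simp at this
  | cons m ms =>
    obtain ⟨⟨q₁, a, q₂, op⟩, ⟨q₃, s₃⟩⟩ := m
    obtain ⟨⟨h1, h2, h3, h4, h5⟩, h6⟩ := hr
    simp only at h2 h3 h4 h5
    subst h2 h4
    have hlen : (w :: s).length < s₃.length := h' (q₃, s₃) (by simp [Run.later])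
    have hop : op = .clone2 := by
      cases op with
      | clone2 => rfl
      | push b =>
        simp only [StackOp.apply, Option.some.injEq] at h5
        subst h5
        simp at hlen
      | pop1 =>
        rcases w with _ | ⟨b, _ | ⟨b', w⟩⟩ <;> simp [StackOp.apply] at h5
        subst h5
        simp at hlen
      | pop2 =>
        cases s <;> simp [StackOp.apply] at h5
        subst h5
        simp at hlen
    subst hop
    obtain rfl : w :: w :: s = s₃ := by simpa [StackOp.apply] using h5
    refine ⟨(q, a, q₃, .clone2), ⟨h1, rfl, by simpa [Stack2.top1] using h3, rfl⟩, _, ?_, rfl⟩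
    refine IsRun.path (s := [w]) (s' := [y]) (t := w :: s) h6 (fun x hx hxs => ?_)
      (fun _ _ _ _ => trivial) ?_
    · have := h' x (by
        simp only [Run.later, List.map_cons]
        exact List.mem_of_mem_dropLast hx)
      rw [hxs] at this
      exact this.false
    · simpa [Run.finish, Run.confs, Run.later] using hf

theorem exists_run_of_clone {q p : Q} {w y : List A} (s : Stack2 A) {δ : N.Tr} {l : List N.Tr}
    (hδ : δ ∈ N.cloneTrans q w) (hl : l ∈ N.relRuns w y δ.2.2.1 p) :
    ∃ ρ : N.Run, ρ.IsFromTo (q, w :: s) (p, y :: w :: s) ∧ ρ.StaysAbove (w :: s).length ∧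
      ρ.word = δ :: l := by
  obtain ⟨ms, h1, h2, h3, h4⟩ := Path.exists_isRun (t := w :: s) hl (by simp)
  obtain ⟨q₁, a, q₂, op⟩ := δ
  obtain ⟨h5, rfl, h6, rfl⟩ := hδ
  refine ⟨⟨(q₁, w :: s), ((q₁, a, q₂, .clone2), (q₂, w :: w :: s)) :: ms, ?_, h1⟩,
    ⟨rfl, ?_⟩, ?_, ?_⟩
  · exact ⟨h5, rfl, by simpa [Stack2.top1] using h6, rfl, rfl⟩
  · simpa [Run.finish, Run.confs, Run.later] using h3
  · intro x hx
    have hx' : x ∈ (((q₂, [w] ++ w :: s) : Config Q A) :: ms.map Prod.snd).dropLast ++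
        [(p, [y] ++ w :: s)] := by
      rw [← h3, List.dropLast_append_getLast]
      simpa [Run.later] using hx
    rcases List.mem_append.1 hx' with hx' | hx'
    · obtain ⟨s₁, hs₁, h7, -⟩ := h4 x hx'
      rw [h7]
      have := List.length_pos_of_ne_nil hs₁
      simp
      omega
    · obtain rfl := List.mem_singleton.1 hx'
      simp
  · simp [Run.word, h2]

end TwoPS

/-! ### The equivalences `≡ⁿ` as right congruences -/

namespace TwoPS

variable {Q : Type u} {A : Type v} {N : TwoPS Q A} {n z : ℕ} {w w' : List A}

/-- The predicates `S^j` of the word models compare a cardinality with `j`. -/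
theorem exists_injective_fin_iff {α : Type*} {S : Set α} {j : ℕ} :
    (∃ r : Fin j → α, Function.Injective r ∧ ∀ t, r t ∈ S) ↔ (j : ℕ∞) ≤ S.encard := by
  constructor
  · rintro ⟨r, hr, hS⟩
    calc (j : ℕ∞) = (Set.univ : Set (Fin j)).encard := by simp
      _ = (r '' Set.univ).encard := (hr.encard_image _).symm
      _ ≤ S.encard := Set.encard_le_encard (by rintro _ ⟨t, -, rfl⟩; exact hS t)
  · intro h
    obtain ⟨T, hT, hTj⟩ := Set.exists_subset_encard_eq h
    have hfin : T.Finite := Set.finite_of_encard_eq_coe hTj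
    have hcard : Nat.card T = j := by
      rw [Nat.card_coe_set_eq, Set.ncard, hTj, ENat.toNat_natCast]
    have := hfin.to_subtype
    let e := (Finite.equivFinOfCardEq hcard).symm
    exact ⟨fun t => (e t).1, fun t t' h => e.injective (Subtype.ext h), fun t => hT (e t).2⟩

theorem forall_le_encard_iff {α β : Type*} {S : Set α} {T : Set β} :
    (∀ j : Fin (z + 1), ((j : ℕ) : ℕ∞) ≤ S.encard ↔ ((j : ℕ) : ℕ∞) ≤ T.encard) ↔
      SameCount z S T := by
  constructor
  · intro h
    have key : ∀ a b : ℕ∞, (∀ j : Fin (z + 1), ((j : ℕ) : ℕ∞) ≤ a → ((j : ℕ) : ℕ∞) ≤ b) →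
        min a z ≤ min b z := by
      intro a b hab
      refine le_min ?_ (min_le_right _ _)
      have hm : min a (z : ℕ∞) ≠ ⊤ := ((min_le_right _ _).trans_lt (ENat.natCast_lt_top z)).ne
      obtain ⟨m, hm⟩ := ENat.ne_top_iff_exists.1 hm
      have hmz : m ≤ z := by exact_mod_cast hm.trans_le (min_le_right _ _)
      rw [← hm]
      exact hab ⟨m, by omega⟩ (hm.trans_le (min_le_left _ _))
    exact le_antisymm (key _ _ fun j => (h j).1) (key _ _ fun j => (h j).2)
  · intro h j
    have hj : ((j : ℕ) : ℕ∞) ≤ z := by exact_mod_cast Nat.lt_succ_iff.1 j.2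
    exact ⟨h.le_encard hj, h.symm.le_encard hj⟩

theorem baseCol_eq_iff {i : Fin w.length} {i' : Fin w'.length} :
    N.baseCol z w i = N.baseCol z w' i' ↔ w[i] = w'[i'] ∧
      (∀ q q', SameCount z (N.relRuns w (w.drop i) q q') (N.relRuns w' (w'.drop i') q q')) ∧
      (∀ q q', SameCount z (N.relReturns (w.drop i) q q') (N.relReturns (w'.drop i') q q')) ∧
      (∀ q q', SameCount z (N.relRuns (w.drop i) (w.drop i) q q')
        (N.relRuns (w'.drop i') (w'.drop i') q q')) ∧
      ∀ q q', SameCount z (N.highLoops [] (w.drop i) q q')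
        (N.highLoops [] (w'.drop i') q q') := by
  have hS : ∀ (w y w' y' : List A) q q',
      SameCount z (N.relRuns w y q q') (N.relRuns w' y' q q') ↔ ∀ j : Fin (z + 1),
        ((∃ r : Fin j → N.Run, Function.Injective r ∧ ∀ t, (r t).IsFromTo (q, [w]) (q', [y])) ↔
          ∃ r : Fin j → N.Run, Function.Injective r ∧
            ∀ t, (r t).IsFromTo (q, [w']) (q', [y'])) := by
    intro w y w' y' q q'
    rw [SameCount, ← encard_runs, ← encard_runs, ← SameCount, ← forall_le_encard_iff]
    exact forall_congr' fun j => iff_congr exists_injective_fin_iff.symm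
      exists_injective_fin_iff.symm
  have hR : ∀ w w' : List A, N.returnFunc z w = N.returnFunc z w' ↔
      ∀ q q', SameCount z (N.relReturns w q q') (N.relReturns w' q q') := by
    intro w w'
    simp only [funext_iff, returnFunc, countUpTo_eq_iff, SameCount, encard_returns]
  have hL : ∀ w w' : List A, N.loopFunc z w = N.loopFunc z w' ↔
      ∀ q q', SameCount z (N.relRuns w w q q') (N.relRuns w' w' q q') := by
    intro w w'
    simp only [funext_iff, loopFunc, countUpTo_eq_iff, SameCount, encard_loops]
  have hH : ∀ w w' : List A, N.highLoopFunc z w = N.highLoopFunc z w' ↔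
      ∀ q q', SameCount z (N.highLoops [] w q q') (N.highLoops [] w' q q') := by
    intro w w'
    simp only [funext_iff, highLoopFunc, countUpTo_eq_iff]
  rw [← hR, ← hL, ← hH]
  simp only [hS]

  constructor
  · intro h
    have h' := fun x => iff_of_eq (congrFun h x)
    exact ⟨((h' (.P w[i])).1 rfl).symm, fun q q' j => h' (.S q q' j), ((h' (.R _)).1 rfl).symm,
      ((h' (.L _)).1 rfl).symm, ((h' (.H _)).1 rfl).symm⟩
  · rintro ⟨h1, h2, h3, h4, h5⟩
    funext x
    cases x with
    | P a => exact congrArg (· = a) h1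
    | S q q' j => exact propext (h2 q q' j)
    | R f => exact congrArg (· = f) h3
    | L f => exact congrArg (· = f) h4
    | H f => exact congrArg (· = f) h5

/-- Equality of colours in `Linⁿ` amounts to equality of the basic colours and equivalence of the
prefixes at all lower levels. -/
theorem lin_col_eq_iff {i : Fin w.length} {i' : Fin w'.length} :
    (N.lin z z n).col w i = (N.lin z z n).col w' i' ↔
      N.baseCol z w i = N.baseCol z w' i' ∧
        ∀ n' < n, N.WordEquiv n' z (w.drop i) (w'.drop i') := by
  induction n with
  | zero => simp [lin]
  | succ n ih =>
    have key : (N.lin z z (n + 1)).col w i = (N.lin z z (n + 1)).col w' i' ↔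
        (N.lin z z n).col w i = (N.lin z z n).col w' i' ∧
          N.WordEquiv n z (w.drop i) (w'.drop i') := by
      constructor
      · intro h
        refine ⟨funext fun x => congrFun h (.inl x), ?_⟩
        exact (iff_of_eq (congrFun h (.inr ⟨_, _, rfl⟩))).2 rfl
      · rintro ⟨h1, h2⟩
        funext x
        cases x with
        | inl x => exact congrFun h1 x
        | inr θ => exact congrArg (· = θ.1) (show (N.lin z z n).typ z _ = _ from h2)
    rw [key, ih, and_assoc, Nat.forall_lt_succ_right]

theorem wordEquiv_iff :
    N.WordEquiv n z w w' ↔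
      BackForth ((N.lin z z n).col w) ((N.lin z z n).col w') z ∅ :=
  (N.lin z z n).typ_eq_iff z w w'

theorem WordEquiv.refl (w : List A) : N.WordEquiv n z w w := Eq.refl _

theorem WordEquiv.symm (h : N.WordEquiv n z w w') : N.WordEquiv n z w' w := Eq.symm h

theorem WordEquiv.trans {w'' : List A} (h : N.WordEquiv n z w w') (h' : N.WordEquiv n z w' w'') :
    N.WordEquiv n z w w'' := Eq.trans h h'

theorem WordEquiv.mono {n' : ℕ} (hn : n' ≤ n) (h : N.WordEquiv n z w w') :
    N.WordEquiv n' z w w' := by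
  rw [wordEquiv_iff] at h ⊢
  refine h.recolor fun x y hxy => ?_
  rw [lin_col_eq_iff] at hxy ⊢
  exact ⟨hxy.1, fun m hm => hxy.2 m (hm.trans_le hn)⟩

theorem WordEquiv.ne_nil (h : N.WordEquiv n z w w') (hz : 2 ≤ z) (hw : w ≠ []) : w' ≠ [] := by
  obtain ⟨k, rfl⟩ : ∃ k, z = k + 1 := ⟨z - 1, by omega⟩
  rw [wordEquiv_iff] at h
  exact List.ne_nil_of_length_pos (h.length_pos_iff.1 (List.length_pos_of_ne_nil hw))

/-- Equivalent nonempty words agree in the basic colours of their first positions; identifying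
the first positions takes quantifier rank 2. -/
theorem WordEquiv.top (h : N.WordEquiv n z w w') (hz : 2 ≤ z) (hw : w ≠ []) :
    w.head? = w'.head? ∧
      (∀ q q', SameCount z (N.relReturns w q q') (N.relReturns w' q q')) ∧
      ∀ q q', SameCount z (N.relRuns w w q q') (N.relRuns w' w' q q') := by
  have hl := List.length_pos_of_ne_nil hw
  have hl' := List.length_pos_of_ne_nil (h.ne_nil hz hw)
  obtain ⟨k, hk⟩ : ∃ k, z = k + 2 := ⟨z - 2, by omega⟩
  have h0 : (N.lin z z n).col w ⟨0, hl⟩ = (N.lin z z n).col w' ⟨0, hl'⟩ := by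
    rw [wordEquiv_iff] at h
    exact (hk ▸ h :
      BackForth ((N.lin z z n).col w) ((N.lin z z n).col w') (k + 2) ∅).color_zero hl hl'
  obtain ⟨h1, -, h3, h4, -⟩ := baseCol_eq_iff.1 (lin_col_eq_iff.1 h0).1
  refine ⟨?_, h3, h4⟩
  rw [List.head?_eq_getElem?, List.head?_eq_getElem?, List.getElem?_eq_getElem hl,
    List.getElem?_eq_getElem hl']
  exact congrArg some h1

theorem not_cons_suffix_self {a : A} {v : List A} : ¬ a :: v <:+ v :=
  fun h => by simpa using h.length_le

theorem not_cons_suffix_drop {a : A} {v : List A} (i : ℕ) : ¬ a :: v <:+ v.drop i :=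
  fun h => not_cons_suffix_self (h.trans (List.drop_suffix _ _))

theorem sameCount_relRuns_cons_left {a : A} {y y' : List A} (hw : w ≠ []) (hw' : w' ≠ [])
    (hy : ¬ a :: w <:+ y) (hy' : ¬ a :: w' <:+ y')
    (hR : ∀ q q', SameCount z (N.relReturns w q q') (N.relReturns w' q q'))
    (hS : ∀ q q', SameCount z (N.relRuns w y q q') (N.relRuns w' y' q q')) (q q' : Q) :
    SameCount z (N.relRuns (a :: w) y q q') (N.relRuns (a :: w') y' q q') := by
  rw [relRuns_cons_left hw hy, relRuns_cons_left hw' hy']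
  exact .spliced (uniqueSplice_pop hw _ _) (uniqueSplice_pop hw' _ _)
    (fun δ => sameCount_relHighLoops hR a _ _) fun δ => hS _ _

theorem sameCount_relRuns_cons_right {a : A} {y y' : List A} (htop : y.head? = y'.head?)
    (hw : ¬ a :: y <:+ w) (hw' : ¬ a :: y' <:+ w')
    (hR : ∀ q q', SameCount z (N.relReturns y q q') (N.relReturns y' q q'))
    (hS : ∀ q q', SameCount z (N.relRuns w y q q') (N.relRuns w' y' q q')) (q q' : Q) :
    SameCount z (N.relRuns w (a :: y) q q') (N.relRuns w' (a :: y') q q') := by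
  have hpush : N.pushTrans y a = N.pushTrans y' a := by simp only [pushTrans, htop]
  rw [relRuns_cons_right hw, relRuns_cons_right hw', hpush]
  exact .spliced (hpush ▸ uniqueSplice_push _ _) (uniqueSplice_push _ _)
    (fun δ => hS _ _) fun δ => sameCount_relHighLoops hR a _ _

theorem sameCount_relRuns_cons_self (a : A) (hw : w ≠ []) (hw' : w' ≠ [])
    (htop : w.head? = w'.head?)
    (hR : ∀ q q', SameCount z (N.relReturns w q q') (N.relReturns w' q q'))
    (hL : ∀ q q', SameCount z (N.relRuns w w q q') (N.relRuns w' w' q q')) (q q' : Q) :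
    SameCount z (N.relRuns (a :: w) (a :: w) q q') (N.relRuns (a :: w') (a :: w') q q') := by
  rw [relRuns_cons_self hw, relRuns_cons_self hw']
  refine (sameCount_relHighLoops hR a _ _).union (.spliced (uniqueSplice_pop hw _ _)
    (uniqueSplice_pop hw' _ _) (fun δ => sameCount_relHighLoops hR a _ _) fun δ => ?_)
    (disjoint_relHighLoops_spliced hw _ _) (disjoint_relHighLoops_spliced hw' _ _)
  exact sameCount_relRuns_cons_right htop not_cons_suffix_self not_cons_suffix_self hR hL _ _

/-- `≡ⁿ` is a right congruence. The basic colours of the new first position are determined by the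
pushed letter and the colours of the old first position, those of the other positions change in a
way that depends only on their colours, and the classes at lower levels are covered by induction. -/
theorem WordEquiv.cons (h : N.WordEquiv n z w w') (hz : 2 ≤ z) (a : A) :
    N.WordEquiv n z (a :: w) (a :: w') := by
  rcases eq_or_ne w [] with rfl | hw
  · rcases eq_or_ne w' [] with rfl | hw'
    · exact WordEquiv.refl _
    · exact absurd rfl (h.symm.ne_nil hz hw')
  have hw' := h.ne_nil hz hw
  obtain ⟨htop, hR, hL⟩ := h.top hz hw
  induction n using Nat.strong_induction_on with
  | _ n ih =>
  have h0 : (N.lin z z n).col (a :: w) (0 : Fin (w.length + 1)) =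
      (N.lin z z n).col (a :: w') (0 : Fin (w'.length + 1)) := by
    have hself := sameCount_relRuns_cons_self a hw hw' htop hR hL
    refine lin_col_eq_iff.2 ⟨baseCol_eq_iff.2 ⟨rfl, hself, sameCount_relReturns_cons hR a, hself,
      fun q q' => ?_⟩, fun m hm => ih m hm (h.mono hm.le)⟩
    change SameCount z (N.highLoops [] (a :: w) q q') (N.highLoops [] (a :: w') q q')
    rw [SameCount, encard_highLoops a hw, encard_highLoops a hw']
    exact sameCount_relHighLoops hR a q q'
  have hs : ∀ (x : Fin w.length) (y : Fin w'.length),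
      (N.lin z z n).col w x = (N.lin z z n).col w' y →
      (N.lin z z n).col (a :: w) x.succ = (N.lin z z n).col (a :: w') y.succ := by
    intro x y hxy
    rw [lin_col_eq_iff] at hxy ⊢
    refine ⟨?_, hxy.2⟩
    obtain ⟨h1, h2, h3⟩ := baseCol_eq_iff.1 hxy.1
    exact baseCol_eq_iff.2 ⟨h1, sameCount_relRuns_cons_left hw hw' (not_cons_suffix_drop _)
      (not_cons_suffix_drop _) hR h2, h3⟩
  rw [wordEquiv_iff] at h ⊢
  have := (BackForth.cons_aux h0 hs (k := z) (P := ∅)).1 h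
  rwa [Set.image_empty] at this

theorem WordEquiv.append (h : N.WordEquiv n z w w') (hz : 2 ≤ z) (x : List A) :
    N.WordEquiv n z (x ++ w) (x ++ w') := by
  induction x with
  | nil => exact h
  | cons a x ih => exact ih.cons hz a

theorem finite_lin_C [Finite Q] [Finite A] (n : ℕ) : Finite (N.lin z z n).C := by
  induction n with
  | zero =>
    change Finite (BaseColor Q A z)
    have e : BaseColor Q A z ≃ A ⊕ (Q × Q × Fin (z + 1)) ⊕ (Q → Q → Fin (z + 1)) ⊕
        (Q → Q → Fin (z + 1)) ⊕ (Q → Q → Fin (z + 1)) :=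
      { toFun := fun
          | .P a => .inl a
          | .S q q' j => .inr (.inl (q, q', j))
          | .R f => .inr (.inr (.inl f))
          | .L f => .inr (.inr (.inr (.inl f)))
          | .H f => .inr (.inr (.inr (.inr f)))
        invFun := fun
          | .inl a => .P a
          | .inr (.inl (q, q', j)) => .S q q' j
          | .inr (.inr (.inl f)) => .R f
          | .inr (.inr (.inr (.inl f))) => .L f
          | .inr (.inr (.inr (.inr f))) => .H f
        left_inv := by rintro (_ | _ | _ | _ | _) <;> rfl
        right_inv := by rintro (_ | ⟨_, _, _⟩ | _ | _ | _) <;> rfl }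
    exact Finite.of_equiv _ e.symm
  | succ n ih =>
    have := (WordColoring.finite_range_typ (N.lin z z n) z).to_subtype
    change Finite ((N.lin z z n).C ⊕ Set.range ((N.lin z z n).typ z))
    infer_instance

theorem finite_quotient_wordSetoid [Finite Q] [Finite A] (n z : ℕ) :
    Finite (Quotient (N.wordSetoid n z)) := by
  have := finite_lin_C (N := N) (z := z) n
  have := (WordColoring.finite_range_typ (N.lin z z n) z).to_subtype
  exact Finite.of_equiv _ (Setoid.quotientKerEquivRange ((N.lin z z n).typ z)).symm

end TwoPS

/-! ### Forks, transfer of runs and pumping -/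

namespace TwoPS

variable {Q : Type u} {A : Type v} {N : TwoPS Q A} {n z : ℕ} {w w' v v' y x : List A}

/-- `v` is the longest common suffix of `w` and `x ++ v`, and it is nonempty. -/
structure IsFork (w v x : List A) : Prop where
  suffix : v <:+ w
  ne_nil : v ≠ []
  not_suffix : ∀ x' c, x = x' ++ [c] → ¬ c :: v <:+ w

theorem IsFork.of_cons {a : A} (h : IsFork w v (a :: x)) : IsFork w v x :=
  ⟨h.suffix, h.ne_nil, fun x' c hx => h.not_suffix (a :: x') c (by simp [hx])⟩

theorem IsFork.not_append_suffix (h : IsFork w v x) (hx : x ≠ []) : ¬ x ++ v <:+ w := by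
  intro hs
  obtain ⟨x', c, rfl⟩ : ∃ x' c, x = x' ++ [c] :=
    ⟨_, _, (List.dropLast_append_getLast hx).symm⟩
  exact h.not_suffix x' c rfl (List.IsSuffix.trans ⟨x', by simp⟩ hs)

theorem isFork_self (hv : v ≠ []) (x : List A) : IsFork v v x :=
  ⟨List.suffix_refl v, hv, fun _ _ _ => not_cons_suffix_self⟩

theorem IsFork.eq_of_suffix {x' : List A} (h : IsFork w v x) (h' : IsFork w v' x')
    (heq : x ++ v = x' ++ v') (hs : v <:+ v') : v = v' := by
  obtain ⟨t, rfl⟩ := hs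
  rcases eq_or_ne t [] with rfl | ht
  · rfl
  · obtain ⟨t', c, rfl⟩ : ∃ t' c, t = t' ++ [c] :=
      ⟨_, _, (List.dropLast_append_getLast ht).symm⟩
    have hx : x = x' ++ t' ++ [c] :=
      List.append_cancel_right (bs := v) (by simpa using heq)
    exact absurd (List.IsSuffix.trans ⟨t', by simp⟩ h'.suffix) (h.not_suffix _ _ hx)

theorem IsFork.unique {x' : List A} (h : IsFork w v x) (h' : IsFork w v' x')
    (heq : x ++ v = x' ++ v') : v = v' := by
  have h1 : v <:+ x ++ v := List.suffix_append _ _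
  have h2 : v' <:+ x ++ v := heq ▸ List.suffix_append _ _
  rcases List.suffix_or_suffix_of_suffix h1 h2 with h3 | h3
  · exact h.eq_of_suffix h' heq h3
  · exact (h'.eq_of_suffix h heq.symm h3).symm

/-- The final word of a run shares a nonempty suffix with the initial one: each letter above the
longest common suffix was pushed during the run, and no word is ever emptied. -/
theorem exists_isFork {q q' : Q} {l : List N.Tr} (hw : w ≠ []) (hl : l ∈ N.relRuns w y q q') :
    ∃ v x, y = x ++ v ∧ IsFork w v x := by
  induction y generalizing l q' with
  | nil => exact absurd rfl (hl.words_ne_nil (by simpa using hw) [] (by simp))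
  | cons a y ih =>
    by_cases hs : a :: y <:+ w
    · exact ⟨a :: y, [], rfl, hs, by simp, by simp⟩
    · rw [relRuns_cons_right hs] at hl
      obtain ⟨l₁, δ, l₂, -, -, h2, -⟩ := hl
      obtain ⟨v, x, rfl, h⟩ := ih h2
      refine ⟨v, a :: x, rfl, h.suffix, h.ne_nil, fun x' c hx => ?_⟩
      cases x' with
      | nil =>
        obtain ⟨rfl, rfl⟩ := List.cons.inj hx
        exact hs
      | cons b x' => exact h.not_suffix x' c (List.cons.inj hx).2

/-- If the forking points are equivalent and reached equally often, then so are the stacks with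
`x` built up above them: the ways to build up `x` depend only on the class of the forking point. -/
theorem sameCount_relRuns_append (hv : N.WordEquiv n z v v') (hz : 2 ≤ z)
    (h : IsFork w v x) (h' : IsFork w' v' x)
    (hS : ∀ q q', SameCount z (N.relRuns w v q q') (N.relRuns w' v' q q')) (q q' : Q) :
    SameCount z (N.relRuns w (x ++ v) q q') (N.relRuns w' (x ++ v') q q') := by
  induction x generalizing q q' with
  | nil => exact hS q q'
  | cons a x ih =>
    obtain ⟨htop, hR, -⟩ := (hv.append hz x).top hz (by simp [h.ne_nil])
    exact sameCount_relRuns_cons_right htop (h.not_append_suffix (by simp))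
      (h'.not_append_suffix (by simp)) hR (ih h.of_cons h'.of_cons) q q'

theorem relRuns_nonempty_trans {q q₁ q' : Q} (h : (N.relRuns w v q q₁).Nonempty)
    (h' : (N.relRuns v y q₁ q').Nonempty) : (N.relRuns w y q q').Nonempty := by
  obtain ⟨l, hl⟩ := h
  obtain ⟨l', hl'⟩ := h'
  exact ⟨l ++ l', path_append.2 ⟨_, hl, hl'⟩⟩

theorem relRuns_nonempty_congr {q q' : Q} (hv : N.WordEquiv n z v v') (hz : 2 ≤ z) (hv0 : v ≠ [])
    (h : (N.relRuns v (x ++ v) q q').Nonempty) : (N.relRuns v' (x ++ v') q q').Nonempty :=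
  (sameCount_relRuns_append hv hz (isFork_self hv0 x) (isFork_self (hv.ne_nil hz hv0) x)
    (hv.top hz hv0).2.2 q q').nonempty (by omega) h

/-- A run that builds up `t ++ x` above the fork passes through the stack with `x` built up. -/
theorem exists_relRuns_split {t : List A} {q q' : Q} {l : List N.Tr} (h : IsFork w v (t ++ x))
    (hl : l ∈ N.relRuns w (t ++ (x ++ v)) q q') : ∃ r, (N.relRuns w (x ++ v) q r).Nonempty ∧
      (N.relRuns (x ++ v) (t ++ (x ++ v)) r q').Nonempty := by
  induction t generalizing l q' with
  | nil => exact ⟨q', ⟨l, hl⟩, [], rfl⟩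
  | cons a t ih =>
    have hs : ¬ a :: (t ++ (x ++ v)) <:+ w := by
      simpa using h.not_append_suffix (by simp)
    rw [List.cons_append, relRuns_cons_right hs] at hl
    obtain ⟨l₁, δ, l₂, -, h1, h2, h3⟩ := hl
    obtain ⟨r, h4, h5⟩ := ih h.of_cons h2
    refine ⟨r, h4, relRuns_nonempty_trans h5 ⟨δ :: l₂, ?_⟩⟩
    exact ⟨trivial, _, relStep_of_mem_pushTrans h1 [], h3.any⟩

/-- Pumping: a long final word can be replaced by a shorter equivalent one whose length avoids
fewer than `m` forbidden values. -/
theorem exists_shorter [Finite Q] [Finite A] {q p : Q} {m : ℕ} (hz : 2 ≤ z) (hw : w ≠ [])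
    (hy : (N.relRuns w y q p).Nonempty)
    (hlen : w.length + m * (Nat.card Q * N.numClasses n z) < y.length)
    (F : Finset ℕ) (hF : F.card < m) :
    ∃ y', y'.length < y.length ∧ y'.length ∉ F ∧ N.WordEquiv n z y' y ∧
      (N.relRuns w y' q p).Nonempty := by
  classical
  obtain ⟨l, hl⟩ := hy
  obtain ⟨v, x, rfl, hf⟩ := exists_isFork hw hl
  have hsplit : ∀ j, ∃ r, (N.relRuns w (x.drop j ++ v) q r).Nonempty ∧
      (N.relRuns (x.drop j ++ v) (x.take j ++ (x.drop j ++ v)) r p).Nonempty := fun j =>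
    exists_relRuns_split (l := l) (by rwa [List.take_append_drop])
      (by rwa [← List.append_assoc, List.take_append_drop])
  choose r hr1 hr2 using hsplit
  have := finite_quotient_wordSetoid (N := N) n z
  have := Fintype.ofFinite (Q × Quotient (N.wordSetoid n z))
  have hcard : Fintype.card (Q × Quotient (N.wordSetoid n z)) = Nat.card Q * N.numClasses n z := by
    rw [← Nat.card_eq_fintype_card, Nat.card_prod, numClasses]
  have hvw := hf.suffix.length_le
  -- More than `m` suffixes of `x` agree in the state at a visit and in the class.
  obtain ⟨κ, -, hκ⟩ := Finset.exists_lt_card_fiber_of_mul_lt_card_of_maps_to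
    (s := Finset.range x.length) (t := Finset.univ) (n := m)
    (f := fun j => (r j, (⟦x.drop j ++ v⟧ : Quotient (N.wordSetoid n z))))
    (fun _ _ => Finset.mem_univ _) (by
      rw [Finset.card_univ, hcard, Finset.card_range, mul_comm]
      simp only [List.length_append] at hlen
      omega)
  set S := (Finset.range x.length).filter
    fun j => (r j, (⟦x.drop j ++ v⟧ : Quotient (N.wordSetoid n z))) = κ with hS
  have hSne : S.Nonempty := Finset.card_pos.1 (by omega)
  have hmem : ∀ j ∈ S, j < x.length ∧ r j = κ.1 ∧ ⟦x.drop j ++ v⟧ = κ.2 := by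
    intro j hj
    rw [hS, Finset.mem_filter, Finset.mem_range, Prod.ext_iff] at hj
    exact hj
  obtain ⟨h0, h0r, h0v⟩ := hmem _ (S.min'_mem hSne)
  -- The part of `x` above its longest such suffix is put on top of each of the shorter ones.
  set i := S.min' hSne with hi
  let y' : ℕ → List A := fun j => x.take i ++ (x.drop j ++ v)
  have hlen' : ∀ j, j < x.length → (y' j).length = i + (x.length - j) + v.length := by
    intro j hj
    simp only [y', List.length_append, List.length_take, List.length_drop]
    omega
  obtain ⟨j, hj, hjF⟩ : ∃ j ∈ S.erase i, (y' j).length ∉ F := by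
    by_contra! hall
    have hinj : Set.InjOn (fun j => (y' j).length) (S.erase i) := by
      intro j hj k hk hjk
      have h1 := (hmem j (Finset.mem_of_mem_erase hj)).1
      have h2 := (hmem k (Finset.mem_of_mem_erase hk)).1
      simp only [hlen' _ h1, hlen' _ h2] at hjk
      omega
    have := Finset.card_le_card_of_injOn _ hall hinj
    rw [Finset.card_erase_of_mem (S.min'_mem hSne)] at this
    omega
  have hjS := Finset.mem_of_mem_erase hj
  obtain ⟨h1, h1r, h1v⟩ := hmem j hjS
  have hij : i < j := lt_of_le_of_ne (S.min'_le j hjS) (Finset.ne_of_mem_erase hj).symm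
  have hequiv : N.WordEquiv n z (x.drop i ++ v) (x.drop j ++ v) :=
    Quotient.exact (h0v.trans h1v.symm)
  refine ⟨y' j, ?_, hjF, ?_, ?_⟩
  · rw [hlen' j h1, List.length_append]
    omega
  · have := hequiv.symm.append hz (x.take i)
    rwa [← List.append_assoc _ (x.drop i), List.take_append_drop] at this
  · refine relRuns_nonempty_trans (hr1 j) ?_
    rw [h1r, ← h0r]
    exact relRuns_nonempty_congr hequiv hz (by simp [hf.ne_nil]) (hr2 i)

theorem cons_drop_suffix_iff {i : ℕ} (hi : i ≤ w.length) {a : A} :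
    a :: w.drop i <:+ w ↔ ∃ k : Fin w.length, (k : ℕ) + 1 = i ∧ w[k] = a := by
  constructor
  · rintro ⟨t, ht⟩
    have hlen := congrArg List.length ht
    simp only [List.length_append, List.length_cons, List.length_drop] at hlen
    have hk : t.length < w.length := by omega
    refine ⟨⟨t.length, hk⟩, by simp; omega, ?_⟩
    have : w[t.length]? = some a := by
      conv_lhs => rw [← ht]
      simp
    simpa [List.getElem?_eq_getElem hk] using this
  · rintro ⟨k, rfl, rfl⟩
    have := List.drop_eq_getElem_cons k.2
    exact this ▸ List.drop_suffix _ _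

/-- If one round is left, Duplicator's answer to a forking point of `w` is a forking point of
`w'`. -/
theorem IsFork.transfer {P : Set (Fin w.length × Fin w'.length)}
    (hP : BackForth ((N.lin z z n).col w) ((N.lin z z n).col w') 1 P) {i : Fin w.length}
    {i' : Fin w'.length} (hi : (i, i') ∈ P) (h : IsFork w (w.drop i) x) :
    IsFork w' (w'.drop i') x := by
  refine ⟨List.drop_suffix _ _, by simp, fun x' c hx hs => h.not_suffix x' c hx ?_⟩
  rw [cons_drop_suffix_iff i'.2.le] at hs
  rw [cons_drop_suffix_iff i.2.le]
  obtain ⟨k', hk', rfl⟩ := hs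
  obtain ⟨k, hk⟩ := hP.2.2 k'
  have hpart := hk.partialIso _ (Set.mem_insert _ _) _ (Set.mem_insert_of_mem _ hi)
  exact ⟨k, hpart.2.1.2 hk', (baseCol_eq_iff.1 (lin_col_eq_iff.1 hpart.2.2).1).1⟩

/-- Fewer than `z` runs over `w` with final words equivalent to `x` are matched injectively by
runs over the equivalent word `w'`. -/
theorem exists_injective_transfer {ι : Type*} [Fintype ι] (hz : 2 ≤ z) (hn : 1 ≤ n)
    (hw : N.WordEquiv n z w w') (hw0 : w ≠ []) (hι : Fintype.card ι < z) {q p : Q} {x : List A}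
    {f : ι → List N.Tr} (hf : Function.Injective f)
    (hfw : ∀ j, ∃ δ ∈ N.cloneTrans q w, ∃ y, N.WordEquiv (n - 1) z y x ∧
      ∃ l ∈ N.relRuns w y δ.2.2.1 p, f j = δ :: l) :
    ∃ g : ι → List N.Tr, Function.Injective g ∧
      ∀ j, ∃ δ ∈ N.cloneTrans q w', ∃ y, N.WordEquiv (n - 1) z y x ∧
        ∃ l ∈ N.relRuns w' y δ.2.2.1 p, g j = δ :: l := by
  classical
  have hfork : ∀ j, ∃ δ ∈ N.cloneTrans q w, ∃ (i : Fin w.length) (t : List A),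
      N.WordEquiv (n - 1) z (t ++ w.drop i) x ∧ IsFork w (w.drop i) t ∧
      ∃ l ∈ N.relRuns w (t ++ w.drop i) δ.2.2.1 p, f j = δ :: l := by
    intro j
    obtain ⟨δ, hδ, y, hy, l, hl, hfj⟩ := hfw j
    obtain ⟨v, t, rfl, ht⟩ := exists_isFork hw0 hl
    have hv := ht.suffix.length_le
    have hv0 := List.length_pos_of_ne_nil ht.ne_nil
    have hd : w.drop (w.length - v.length) = v := (List.suffix_iff_eq_drop.1 ht.suffix).symm
    refine ⟨δ, hδ, ⟨w.length - v.length, by omega⟩, t, ?_, ?_, l, ?_, hfj⟩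
    · simpa only [hd] using hy
    · simpa only [hd] using ht
    · simpa only [hd] using hl
  choose δ hδ i t hx ht l hl hfl using hfork
  obtain ⟨P, hP, -, hcov⟩ : ∃ P, BackForth ((N.lin z z n).col w) ((N.lin z z n).col w') 1 P ∧
      ∅ ⊆ P ∧ ∀ k ∈ Finset.univ.image i, ∃ k', (k, k') ∈ P := by
    refine BackForth.exists_cover (Finset.univ.image i) ((wordEquiv_iff.1 hw).mono ?_)
    have := Finset.card_image_le (s := Finset.univ) (f := i)
    rw [Finset.card_univ] at this
    omega
  have hcov' : ∀ j, ∃ k', (i j, k') ∈ P := fun j =>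
    hcov _ (Finset.mem_image_of_mem i (Finset.mem_univ j))
  choose i' hi' using hcov'
  have hii : ∀ j k, i j = i k ↔ i' j = i' k := fun j k =>
    (hP.partialIso _ (hi' j) _ (hi' k)).1
  have hcol : ∀ j, (N.lin z z n).col w (i j) = (N.lin z z n).col w' (i' j) := fun j =>
    (hP.partialIso _ (hi' j) _ (hi' j)).2.2
  have hv : ∀ j, N.WordEquiv (n - 1) z (w.drop (i j)) (w'.drop (i' j)) := fun j =>
    (lin_col_eq_iff.1 (hcol j)).2 _ (by omega)
  have ht' : ∀ j, IsFork w' (w'.drop (i' j)) (t j) := fun j => (ht j).transfer hP (hi' j)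
  have hcount : ∀ j q q', SameCount z (N.relRuns w (t j ++ w.drop (i j)) q q')
      (N.relRuns w' (t j ++ w'.drop (i' j)) q q') := fun j =>
    sameCount_relRuns_append (hv j) hz (ht j) (ht' j)
      (baseCol_eq_iff.1 (lin_col_eq_iff.1 (hcol j)).1).2.1
  -- Runs are matched separately for each first transition, forking point, and word built up above
  -- it; these data can be recovered from the matched run.
  have hfib : ∀ j₀, ∃ g : ι → List N.Tr,
      Set.InjOn g (Finset.univ.filter fun j => (δ j, i j, t j) = j₀) ∧
      ∀ j ∈ Finset.univ.filter fun j => (δ j, i j, t j) = j₀,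
        g j ∈ N.relRuns w' (t j ++ w'.drop (i' j)) (δ j).2.2.1 p := by
    intro κ
    set J := Finset.univ.filter fun j => (δ j, i j, t j) = κ with hJ
    rcases J.eq_empty_or_nonempty with h0 | ⟨j₀, hj₀⟩
    · rw [h0]
      exact ⟨fun _ => [], by simp⟩
    · have hmem : ∀ j ∈ J, δ j = δ j₀ ∧ i j = i j₀ ∧ t j = t j₀ := by
        intro j hj
        rw [hJ, Finset.mem_filter] at hj hj₀
        have := hj.2.trans hj₀.2.symm
        simpa using this
      obtain ⟨g, hg1, hg2⟩ := (hcount j₀ (δ j₀).2.2.1 p).exists_injOn (J := J) (f := l)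
        ((Finset.card_le_univ _).trans hι.le)
        (fun j hj k hk hjk => hf (by
          rw [hfl, hfl, hjk, (hmem j hj).1, (hmem k hk).1]))
        (fun j hj => by
          obtain ⟨h1, h2, h3⟩ := hmem j hj
          rw [← h1, ← h2, ← h3]
          exact hl j)
      refine ⟨g, hg1, fun j hj => ?_⟩
      obtain ⟨h1, h2, h3⟩ := hmem j hj
      rw [h1, (hii _ _).1 h2, h3]
      exact hg2 j hj
  choose G hG1 hG2 using hfib
  have hG2' : ∀ j, G (δ j, i j, t j) j ∈ N.relRuns w' (t j ++ w'.drop (i' j)) (δ j).2.2.1 p :=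
    fun j => hG2 _ j (by simp)
  refine ⟨fun j => δ j :: G (δ j, i j, t j) j, fun j k hjk => ?_, fun j => ?_⟩
  · obtain ⟨h1, h2⟩ := List.cons.inj hjk
    have h3 := hG2' k
    rw [← h2, ← h1] at h3
    have h4 : t j ++ w'.drop (i' j) = t k ++ w'.drop (i' k) := by
      simpa using Path.det (hG2' j) h3
    have h5 := (ht' j).unique (ht' k) h4
    have h6 : i' j = i' k := by
      have := congrArg List.length h5
      simp only [List.length_drop] at this
      exact Fin.ext (by omega)
    rw [h5] at h4
    have h7 : (δ j, i j, t j) = (δ k, i k, t k) := by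
      rw [h1, (hii j k).2 h6, List.append_cancel_right h4]
    rw [← h7] at h2
    exact hG1 (δ j, i j, t j) (by simp) (by simpa using h7.symm) h2
  · refine ⟨δ j, ?_, _, ((hv j).symm.append hz (t j)).trans (hx j), _, hG2' j, rfl⟩
    have := hδ j
    rwa [cloneTrans, (hw.top hz hw0).1] at this

end TwoPS

/-! ### The one step transfer -/

theorem mainTheorem5 {Q : Type u} {A : Type v} [Finite Q] [Finite A] (N : TwoPS Q A)
    (n z m : ℕ) (hn : 1 ≤ n) (hzm : m < z) (hz : 2 ≤ z) (hm : 1 ≤ m)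
    (q : Q) (s sh : Stack2 A) (w wh : List A)
    (hs : Stack2.IsStack (w :: s)) (hsh : Stack2.IsStack (wh :: sh))
    (hw : N.WordEquiv n z w wh)
    (p : ℕ → Q) (x xh : ℕ → List A) (ρ ρh : ℕ → N.Run)
    (hρ_inj : Set.InjOn ρ (Set.Icc 1 m))
    (hρ : ∀ i ∈ Set.Icc 1 m, (ρ i).IsFromTo (q, w :: s) (p i, x i :: w :: s) ∧
      (ρ i).StaysAbove (w :: s).length)
    (hρh_inj : Set.InjOn ρh (Set.Icc 1 (m - 1)))
    (hρh : ∀ i ∈ Set.Icc 1 (m - 1), (ρh i).IsFromTo (q, wh :: sh) (p i, xh i :: wh :: sh) ∧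
      (ρh i).StaysAbove (wh :: sh).length)
    (hx : ∀ i ∈ Set.Icc 1 (m - 1), N.WordEquiv (n - 1) z (x i) (xh i)) :
    ∃ (σ : N.Run) (y : List A),
      σ.IsFromTo (q, wh :: sh) (p m, y :: wh :: sh) ∧
      σ.StaysAbove (wh :: sh).length ∧
      N.WordEquiv (n - 1) z (x m) y ∧
      (∀ i ∈ Set.Icc 1 (m - 1), σ ≠ ρh i) ∧
      y.length ≤ N.oneStepBound m wh.length n z := by
  classical
  have hw0 : w ≠ [] := hs.2 w (by simp)
  have hwh0 : wh ≠ [] := hsh.2 wh (by simp)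
  have hρh' : ∀ i ∈ Set.Icc 1 (m - 1), ∃ δ ∈ N.cloneTrans q wh,
      ∃ l ∈ N.relRuns wh (xh i) δ.2.2.1 (p i), (ρh i).word = δ :: l := fun i hi =>
    TwoPS.exists_clone_of_staysAbove (hρh i hi).1 (hρh i hi).2
  -- Some run differs from all given ones; below, one with final word of minimal length is taken.
  have hgood : ∃ k, ∃ δ ∈ N.cloneTrans q wh, ∃ y, ∃ l ∈ N.relRuns wh y δ.2.2.1 (p m),
      N.WordEquiv (n - 1) z y (x m) ∧ (∀ i ∈ Set.Icc 1 (m - 1), (ρh i).word ≠ δ :: l) ∧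
      y.length = k := by
    -- Only the indices in `J` matter: a given run over `wh` with another index ends in a different
    -- state or class. There are fewer of them below `m` than transferred runs.
    set J := (Finset.Icc 1 m).filter
      fun j => p j = p m ∧ N.WordEquiv (n - 1) z (x j) (x m) with hJ
    have hJm : ∀ j ∈ J, j ∈ Set.Icc 1 m ∧ p j = p m ∧ N.WordEquiv (n - 1) z (x j) (x m) := by
      intro j hj
      rw [hJ, Finset.mem_filter, Finset.mem_Icc] at hj
      exact hj
    have hmJ : m ∈ J := by
      rw [hJ, Finset.mem_filter, Finset.mem_Icc]
      exact ⟨⟨hm, le_rfl⟩, rfl, TwoPS.WordEquiv.refl _⟩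
    have hcard : Fintype.card J < z := by
      rw [Fintype.card_coe]
      have : J.card ≤ (Finset.Icc 1 m).card := Finset.card_filter_le _ _
      rw [Nat.card_Icc] at this
      omega
    obtain ⟨g, hg, hgJ⟩ := TwoPS.exists_injective_transfer (q := q) (p := p m) (x := x m)
      hz hn hw hw0 hcard (f := fun j : J => (ρ j).word)
      (fun j k hjk => Subtype.ext (hρ_inj (hJm j j.2).1 (hJm k k.2).1 (TwoPS.Run.ext_word
        ((hρ j (hJm j j.2).1).1.1.trans (hρ k (hJm k k.2).1).1.1.symm) hjk)))
      (fun j => by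
        obtain ⟨h1, h2, h3⟩ := hJm j j.2
        obtain ⟨δ, hδ, l, hl, hlw⟩ := TwoPS.exists_clone_of_staysAbove (hρ j h1).1 (hρ j h1).2
        exact ⟨δ, hδ, _, h3, l, h2 ▸ hl, hlw⟩)
    obtain ⟨j, hj⟩ : ∃ j, ∀ i ∈ Set.Icc 1 (m - 1), (ρh i).word ≠ g j := by
      by_contra! hall
      choose φ hφ hφg using hall
      have hφJ : ∀ j, φ j ∈ J.erase m := by
        intro j
        obtain ⟨δ, -, y, hy, l, hl, hgl⟩ := hgJ j
        obtain ⟨δ', -, l', hl', hw'⟩ := hρh' _ (hφ j)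
        have heq := hw'.symm.trans ((hφg j).trans hgl)
        obtain ⟨rfl, rfl⟩ := List.cons.inj heq
        have hdet := TwoPS.Path.det hl' hl
        simp only [Prod.mk.injEq, List.cons.injEq, and_true] at hdet
        have hφ' := hφ j
        rw [Set.mem_Icc] at hφ'
        rw [Finset.mem_erase, hJ, Finset.mem_filter, Finset.mem_Icc]
        exact ⟨by omega, ⟨hφ'.1, by omega⟩, hdet.1, (hx _ (hφ j)).trans (hdet.2 ▸ hy)⟩
      have := Fintype.card_le_of_injective (fun j : J => (⟨φ j, hφJ j⟩ : J.erase m))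
        (fun j k hjk => hg (by rw [← hφg, ← hφg, show φ j = φ k from congrArg Subtype.val hjk]))
      rw [Fintype.card_coe, Fintype.card_coe, Finset.card_erase_of_mem hmJ] at this
      have := Finset.card_pos.2 ⟨m, hmJ⟩
      omega
    obtain ⟨δ, hδ, y, hy, l, hl, hgl⟩ := hgJ j
    exact ⟨_, δ, hδ, y, l, hl, hy, fun i hi => hgl ▸ hj i hi, rfl⟩
  obtain ⟨δ, hδ, y, l, hl, hy, hne, hylen⟩ := Nat.find_spec hgood
  obtain ⟨σ, h1, h2, h3⟩ := TwoPS.exists_run_of_clone sh hδ hl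
  refine ⟨σ, y, h1, h2, hy.symm, fun i hi h => hne i hi (h ▸ h3), ?_⟩
  -- Otherwise pumping gives a shorter final word whose length differs from those of all `xh i`.
  by_contra hlong
  rw [TwoPS.oneStepBound] at hlong
  obtain ⟨y', hlt, hF, hy', l', hl'⟩ := TwoPS.exists_shorter (n := n) (z := z) (m := m) hz hwh0
    ⟨l, hl⟩ (by omega) ((Finset.Icc 1 (m - 1)).image fun i => (xh i).length) (by
      have := Finset.card_image_le (s := Finset.Icc 1 (m - 1)) (f := fun i => (xh i).length)
      rw [Nat.card_Icc] at this
      omega)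
  refine Nat.find_min hgood (hylen ▸ hlt) ⟨δ, hδ, y', l', hl', ?_, fun i hi heq => hF ?_, rfl⟩
  · exact (hy'.mono (Nat.sub_le _ _)).trans hy
  · obtain ⟨δ', -, l'', hl'', hw'⟩ := hρh' i hi
    obtain ⟨rfl, rfl⟩ := List.cons.inj (hw'.symm.trans heq)
    have hdet := TwoPS.Path.det hl'' hl'
    simp only [Prod.mk.injEq, List.cons.injEq, and_true] at hdet
    rw [← hdet.2]
    exact Finset.mem_image_of_mem _ (Finset.mem_Icc.2 hi)
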